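/- Let $k$ be a commutative base ring (for instance a field). Algebras are associative unital $k$-algebras, and $(A,B)$-bimodules are $k$-central. Let $B_1,B_2$ be two-sided noetherian $k$-algebras and $d\in\mathbb N$. **Dimension function.** Let $\partial$ assign to every left or right module over $B_1$ or $B_2$ a value in $\mathbb R_{\ge 0}\cup\{\pm\infty\}$, invariant under isomorphism, and on each of these four module categories be an exact dimension function: $\partial(M)=-\infty$ iff $M=0$; $\partial(M)=\max\{\partial(N),\partial(M/N)\}$ for every submodule $N\subseteq M$; and $\partial(\bigcup_i M_i)=\sup_i\partial(M_i)$ for every (nonempty) directed family of submodules. Suppose further that for $(A,B)=(B_1,B_2)$ and $(A,B)=(B_2,B_1)$ the following two conditions hold. 1. For every $(A,B)$-bimodule $M$: if $M_B$ is finitely generated then $\partial({}_AM)\le\partial(M_B)$, and if ${}_AM$ is finitely generated then $\partial(M_B)\le\partial({}_AM)$. 2. ($\gamma_{d-2,1}(A,B)$) For every $(A,B)$-bimodule $M$ finitely generated on both sides and $j\in\{0,1\}$: if $N$ is a finitely generated right $A$-module with $\partial(N)\le d-2$, then $\operatorname{Tor}^A_j(N,M)$ is a finitely generated right $B$-module with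 $\partial\le d-2$; and if $N$ is a finitely generated left $B$-module with $\partial(N)\le d-2$, then $\operatorname{Tor}^B_j(M,N)$ is a finitely generated left $A$-module with $\partial\le d-2$. **Algebras.** For a left or right $A$-module $M$ let $j(M)=\inf\{i:\operatorname{Ext}^i_A(M,A)\ne0\}\in\mathbb N\cup\{\infty\}$. The algebra $A$ is *Auslander–Gorenstein* if $\operatorname{injdim}A_A=\operatorname{injdim}{}_AA<\infty$ and, for every finitely generated left or right $A$-module $M$ and every $q\ge 0$, every $A$-submodule $N$ of $\operatorname{Ext}^q_A(M,A)$ satisfies $j(N)\ge q$. It is *$\partial$-CM of dimension $d$* if $\partial({}_AA)=\partial(A_A)=d$ and $j(M)+\partial(M)=d$ for every nonzero finitely generated left or right $A$-module $M$. Suppose that $B_1$ and $B_2$ are Auslander–Gorenstein and $\partial$-CM of dimension $d$. **$n$-isomorphism.** For $n\in\mathbb Z$, two $(D,A)$-bimodules $X,Y$ are *$n$-isomorphic*, $X\cong_nY$, if there are a $(D,A)$-bimodule $P$ and bimodule maps $X\to P$ and $Y\to P$ whose kernels and cokernels, as right $A$-modules, have $\partial\le n$. **Proposition 3.9.** Suppose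 that there are bimodules ${}_{B_1}T_{B_2}$ and ${}_{B_2}\widetilde T_{B_1}$, finitely generated on both sides, such that $$T\otimes_{B_2}\widetilde T\cong_{d-2}B_1\quad\text{and}\quad \widetilde T\otimes_{B_1}T\cong_{d-2}B_2$$ as bimodules. Then there are bimodules ${}_{B_1}U_{B_2}$ and ${}_{B_2}V_{B_1}$, finitely generated on both sides, each reflexive as a left module and as a right module (that is, the natural map from the module to its double dual over the algebra acting on that side is an isomorphism), such that $$U\otimes_{B_2}V\cong_{d-2}B_1\quad\text{and}\quad V\otimes_{B_1}U\cong_{d-2}B_2$$ as bimodules. -/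

import Mathlib

open CategoryTheory
open scoped TensorProduct

universe v u

noncomputable section

/-! Conventions: a right module over `A` is a module over `Aᵐᵒᵖ`, a left module over `A` is a module
over `A`.  The ring `A` itself is a left module over `A` and (by right multiplication) a module
over `Aᵐᵒᵖ`. -/

/-! ### Dimension functions -/

/-- A function assigning a value in the extended reals to every module over every ring; the left
`A`-modules are evaluated at the ring `A`, the right `A`-modules at the ring `Aᵐᵒᵖ`. -/
abbrev DimFunction : Type (u + 1) :=
  ∀ (R : Type u) [Ring R] (M : Type u) [AddCommGroup M] [Module R M], EReal

/-- `δ` restricts to a dimension function on the modules over `R`. -/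
structure DimFunction.IsDimension (δ : DimFunction.{u}) (R : Type u) [Ring R] : Prop where
  /-- The values lie in `ℝ≥0 ∪ {-∞, +∞}`. -/
  bot_or_nonneg : ∀ (M : Type u) [AddCommGroup M] [Module R M], δ R M = ⊥ ∨ 0 ≤ δ R M
  /-- Isomorphic modules have the same dimension. -/
  congr : ∀ (M N : Type u) [AddCommGroup M] [AddCommGroup N] [Module R M] [Module R N],
    (M ≃ₗ[R] N) → δ R M = δ R N
  eq_bot_iff : ∀ (M : Type u) [AddCommGroup M] [Module R M], δ R M = ⊥ ↔ Subsingleton M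
  max_le : ∀ (M : Type u) [AddCommGroup M] [Module R M] (N : Submodule R M),
    max (δ R N) (δ R (M ⧸ N)) ≤ δ R M

/-- `δ` restricts to an exact dimension function on the modules over `R`. -/
structure DimFunction.IsExact (δ : DimFunction.{u}) (R : Type u) [Ring R] : Prop
    extends δ.IsDimension R where
  eq_max : ∀ (M : Type u) [AddCommGroup M] [Module R M] (N : Submodule R M),
    δ R M = max (δ R N) (δ R (M ⧸ N))
  /-- Compatibility with directed unions of submodules (`sSup` of a directed family of submodules
  is its union). -/
  sSup_directed : ∀ (M : Type u) [AddCommGroup M] [Module R M] (F : Set (Submodule R M)),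
    F.Nonempty → DirectedOn (· ≤ ·) F → δ R (sSup F : Submodule R M) = ⨆ N ∈ F, δ R N

/-! ### Bimodules -/

/-- `(A, B)`-bimodules over the base ring `k`: left `A`-modules and right `B`-modules with
commuting actions, on which both actions restrict to the same action of `k`.
No finiteness is required. -/
structure AlgBimodule (k : Type v) [CommRing k] (A B : Type u) [Ring A] [Algebra k A]
    [Ring B] [Algebra k B] where
  carrier : Type u
  [addCommGroup : AddCommGroup carrier]
  [leftModule : Module A carrier]
  [rightModule : Module Bᵐᵒᵖ carrier]
  [smulCommClass : SMulCommClass A Bᵐᵒᵖ carrier]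
  central : ∀ (c : k) (m : carrier),
    algebraMap k A c • m = MulOpposite.op (algebraMap k B c) • m

namespace AlgBimodule

variable {k : Type v} [CommRing k] {A B C : Type u} [Ring A] [Algebra k A] [Ring B] [Algebra k B]
  [Ring C] [Algebra k C]

instance : CoeSort (AlgBimodule k A B) (Type u) := ⟨AlgBimodule.carrier⟩

attribute [instance] AlgBimodule.addCommGroup AlgBimodule.leftModule AlgBimodule.rightModule
  AlgBimodule.smulCommClass

/-- The bimodule is finitely generated on both sides. -/
def IsFG (M : AlgBimodule k A B) : Prop := Module.Finite A M ∧ Module.Finite Bᵐᵒᵖ M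

variable (k A) in
/-- The algebra `A` as a bimodule over itself. -/
def regular : AlgBimodule k A A where
  carrier := A
  central c m := by
    simp only [smul_eq_mul, MulOpposite.smul_eq_mul_unop, MulOpposite.unop_op]
    exact Algebra.commutes c m

/-- Morphisms of bimodules: right linear maps that are also left linear. -/
structure Hom (X Y : AlgBimodule k A B) extends X →ₗ[Bᵐᵒᵖ] Y where
  map_left_smul : ∀ (a : A) (x : X), toFun (a • x) = a • toFun x

/-- The kernel and the cokernel of a bimodule morphism, viewed as right modules, have dimension at
most `n`. -/
def Hom.IsNIso (δ : DimFunction.{u}) (n : ℤ) {X Y : AlgBimodule k A B} (f : Hom X Y) : Prop :=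
  δ Bᵐᵒᵖ (LinearMap.ker f.toLinearMap) ≤ ((n : ℝ) : EReal) ∧
    δ Bᵐᵒᵖ (Y ⧸ LinearMap.range f.toLinearMap) ≤ ((n : ℝ) : EReal)

/-- The bimodules `X` and `Y` are `n`-isomorphic. -/
def NIsomorphic (δ : DimFunction.{u}) (n : ℤ) (X Y : AlgBimodule k A B) : Prop :=
  ∃ (P : AlgBimodule k A B) (f : Hom X P) (g : Hom Y P), f.IsNIso δ n ∧ g.IsNIso δ n

end AlgBimodule

/-! ### Tensor products over noncommutative rings -/

section Tensor

/-- The subgroup generated by the relations `m r ⊗ n = m ⊗ r n`. -/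
def NCTensor.relations (R M N : Type u) [Ring R] [AddCommGroup M] [Module Rᵐᵒᵖ M]
    [AddCommGroup N] [Module R N] : AddSubgroup (M ⊗[ℤ] N) :=
  AddSubgroup.closure {x | ∃ (m : M) (r : R) (n : N),
    x = (MulOpposite.op r • m) ⊗ₜ[ℤ] n - m ⊗ₜ[ℤ] (r • n)}

/-- The tensor product over `R` of a right `R`-module `M` and a left `R`-module `N`. -/
def NCTensor (R M N : Type u) [Ring R] [AddCommGroup M] [Module Rᵐᵒᵖ M]
    [AddCommGroup N] [Module R N] : Type u :=
  (M ⊗[ℤ] N) ⧸ NCTensor.relations R M N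

namespace NCTensor

variable {R M M' M'' N N' N'' : Type u} [Ring R]
  [AddCommGroup M] [Module Rᵐᵒᵖ M] [AddCommGroup M'] [Module Rᵐᵒᵖ M']
  [AddCommGroup M''] [Module Rᵐᵒᵖ M'']
  [AddCommGroup N] [Module R N] [AddCommGroup N'] [Module R N'] [AddCommGroup N''] [Module R N'']

instance : AddCommGroup (NCTensor R M N) :=
  inferInstanceAs (AddCommGroup ((M ⊗[ℤ] N) ⧸ NCTensor.relations R M N))

variable (R M N) in
/-- The projection from the tensor product over `ℤ`. -/
def mk : M ⊗[ℤ] N →+ NCTensor R M N := QuotientAddGroup.mk' (NCTensor.relations R M N)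

variable (R) in
/-- The pure tensor `m ⊗ n`. -/
def tmul (m : M) (n : N) : NCTensor R M N := mk R M N (m ⊗ₜ[ℤ] n)

theorem tmul_add (m : M) (n n' : N) : tmul R m (n + n') = tmul R m n + tmul R m n' := by
  simp only [tmul, TensorProduct.tmul_add, map_add]

theorem add_tmul (m m' : M) (n : N) : tmul R (m + m') n = tmul R m n + tmul R m' n := by
  simp only [tmul, TensorProduct.add_tmul, map_add]

theorem smul_tmul (r : R) (m : M) (n : N) :
    tmul R (MulOpposite.op r • m) n = tmul R m (r • n) := by
  rw [← sub_eq_zero]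
  simp only [tmul, ← map_sub]
  exact (QuotientAddGroup.eq_zero_iff _).2 (AddSubgroup.subset_closure ⟨m, r, n, rfl⟩)

theorem addHom_ext {G : Type*} [AddCommGroup G] {φ ψ : NCTensor R M N →+ G}
    (h : ∀ m n, φ (tmul R m n) = ψ (tmul R m n)) : φ = ψ := by
  have key : φ.comp (mk R M N) = ψ.comp (mk R M N) := by
    refine AddMonoidHom.ext fun z => ?_
    induction z using TensorProduct.induction_on with
    | zero => simp only [map_zero]
    | tmul m n => exact h m n
    | add x y hx hy => simp only [map_add, hx, hy]
  ext x
  obtain ⟨x, rfl⟩ := QuotientAddGroup.mk'_surjective _ x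
  exact DFunLike.congr_fun key x

/-- The tensor product of two linear maps, as an additive map. -/
def map (f : M →ₗ[Rᵐᵒᵖ] M') (g : N →ₗ[R] N') : NCTensor R M N →+ NCTensor R M' N' :=
  QuotientAddGroup.lift (NCTensor.relations R M N)
    ((mk R M' N').comp (TensorProduct.map f.toAddMonoidHom.toIntLinearMap
      g.toAddMonoidHom.toIntLinearMap).toAddMonoidHom) (by
      rw [NCTensor.relations, AddSubgroup.closure_le]
      rintro _ ⟨m, r, n, rfl⟩
      have e := smul_tmul r (f m) (g n)
      rw [← map_smul, ← map_smul] at e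
      rw [SetLike.mem_coe, AddMonoidHom.mem_ker, map_sub]
      exact sub_eq_zero.2 e)

@[simp]
theorem map_tmul (f : M →ₗ[Rᵐᵒᵖ] M') (g : N →ₗ[R] N') (m : M) (n : N) :
    map f g (tmul R m n) = tmul R (f m) (g n) := rfl

theorem map_id : map (LinearMap.id : M →ₗ[Rᵐᵒᵖ] M) (LinearMap.id : N →ₗ[R] N) =
    AddMonoidHom.id _ :=
  addHom_ext fun _ _ => rfl

theorem map_comp (f : M →ₗ[Rᵐᵒᵖ] M') (f' : M' →ₗ[Rᵐᵒᵖ] M'') (g : N →ₗ[R] N')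
    (g' : N' →ₗ[R] N'') : map (f' ∘ₗ f) (g' ∘ₗ g) = (map f' g').comp (map f g) :=
  addHom_ext fun _ _ => rfl

theorem map_add_left (f f' : M →ₗ[Rᵐᵒᵖ] M') (g : N →ₗ[R] N') :
    map (f + f') g = map f g + map f' g :=
  addHom_ext fun m n => by simp [add_tmul]

theorem map_add_right (f : M →ₗ[Rᵐᵒᵖ] M') (g g' : N →ₗ[R] N') :
    map f (g + g') = map f g + map f g' :=
  addHom_ext fun m n => by simp [tmul_add]

theorem map_zero_left (g : N →ₗ[R] N') : map (0 : M →ₗ[Rᵐᵒᵖ] M') g = 0 := by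
  simpa using map_add_left (0 : M →ₗ[Rᵐᵒᵖ] M') 0 g

theorem map_zero_right (f : M →ₗ[Rᵐᵒᵖ] M') : map f (0 : N →ₗ[R] N') = 0 := by
  simpa using map_add_right f (0 : N →ₗ[R] N') 0

/-- The action `s (m ⊗ n) = (s m) ⊗ n` coming from an action on the left factor. -/
abbrev leftAction (S : Type u) [Ring S] [Module S M] [SMulCommClass S Rᵐᵒᵖ M] :
    Module S (NCTensor R M N) where
  smul s x := map (DistribSMul.toLinearMap Rᵐᵒᵖ M s) LinearMap.id x
  one_smul x := by
    refine (DFunLike.congr_fun (?_ : map _ _ = AddMonoidHom.id _) x)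
    exact addHom_ext fun m n => by simp
  mul_smul s t x := by
    refine (DFunLike.congr_fun (?_ : map _ _ = (map _ _).comp (map _ _)) x)
    exact addHom_ext fun m n => by simp [mul_smul]
  smul_zero s := map_zero (map _ _)
  smul_add s := map_add (map _ _)
  add_smul s t x := by
    refine (DFunLike.congr_fun (?_ : map _ _ = map _ _ + map _ _) x)
    exact addHom_ext fun m n => by simp [add_smul, add_tmul]
  zero_smul x := by
    refine (DFunLike.congr_fun (?_ : map _ _ = 0) x)
    exact addHom_ext fun m n => by simpa using add_tmul (R := R) (0 : M) 0 n

/-- The action `s (m ⊗ n) = m ⊗ (s n)` coming from an action on the right factor. -/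
abbrev rightAction (S : Type u) [Ring S] [Module S N] [SMulCommClass S R N] :
    Module S (NCTensor R M N) where
  smul s x := map LinearMap.id (DistribSMul.toLinearMap R N s) x
  one_smul x := by
    refine (DFunLike.congr_fun (?_ : map _ _ = AddMonoidHom.id _) x)
    exact addHom_ext fun m n => by simp
  mul_smul s t x := by
    refine (DFunLike.congr_fun (?_ : map _ _ = (map _ _).comp (map _ _)) x)
    exact addHom_ext fun m n => by simp [mul_smul]
  smul_zero s := map_zero (map _ _)
  smul_add s := map_add (map _ _)
  add_smul s t x := by
    refine (DFunLike.congr_fun (?_ : map _ _ = map _ _ + map _ _) x)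
    exact addHom_ext fun m n => by simp [add_smul, tmul_add]
  zero_smul x := by
    refine (DFunLike.congr_fun (?_ : map _ _ = 0) x)
    exact addHom_ext fun m n => by simpa using tmul_add (R := R) m (0 : N) 0

end NCTensor

end Tensor

namespace AlgBimodule

variable {k : Type v} [CommRing k] {A B C : Type u} [Ring A] [Algebra k A] [Ring B] [Algebra k B]
  [Ring C] [Algebra k C]

instance (M : AlgBimodule k A B) : SMulCommClass Bᵐᵒᵖ A M := SMulCommClass.symm _ _ _

/-- The `(A, C)`-bimodule `X ⊗_B Y`. -/
def tensor (X : AlgBimodule k A B) (Y : AlgBimodule k B C) : AlgBimodule k A C where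
  carrier := NCTensor B X Y
  leftModule := NCTensor.leftAction A
  rightModule := NCTensor.rightAction Cᵐᵒᵖ
  smulCommClass := by
    let : Module A (NCTensor B X Y) := NCTensor.leftAction A
    let : Module Cᵐᵒᵖ (NCTensor B X Y) := NCTensor.rightAction Cᵐᵒᵖ
    refine ⟨fun a c x => ?_⟩
    refine (DFunLike.congr_fun
      (?_ : (NCTensor.map _ _).comp (NCTensor.map _ _) =
        (NCTensor.map _ _).comp (NCTensor.map _ _)) x)
    exact NCTensor.addHom_ext fun m n => by simp
  central c x := by
    refine (DFunLike.congr_fun (?_ : NCTensor.map _ _ = NCTensor.map _ _) x)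
    exact NCTensor.addHom_ext fun m n => by
      simp [X.central, ← Y.central, NCTensor.smul_tmul]

/-- The right `B`-module `N ⊗_A M`, for a right `A`-module `N`. -/
def tensorRightObj (M : AlgBimodule k A B) (N : ModuleCat.{u} Aᵐᵒᵖ) : ModuleCat.{u} Bᵐᵒᵖ :=
  @ModuleCat.of Bᵐᵒᵖ _ (NCTensor A N M) _ (NCTensor.rightAction Bᵐᵒᵖ)

/-- The left `A`-module `M ⊗_B N`, for a left `B`-module `N`. -/
def tensorLeftObj (M : AlgBimodule k A B) (N : ModuleCat.{u} B) : ModuleCat.{u} A :=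
  @ModuleCat.of A _ (NCTensor B M N) _ (NCTensor.leftAction A)

/-- The functor `N ↦ N ⊗_A M` from right `A`-modules to right `B`-modules. -/
def tensorRightFunctor (M : AlgBimodule k A B) :
    ModuleCat.{u} Aᵐᵒᵖ ⥤ ModuleCat.{u} Bᵐᵒᵖ where
  obj N := M.tensorRightObj N
  map {N N'} f := @ModuleCat.ofHom Bᵐᵒᵖ _ (M.tensorRightObj N) (M.tensorRightObj N') _ _ _ _
    { toFun := NCTensor.map f.hom LinearMap.id
      map_add' := map_add (NCTensor.map f.hom LinearMap.id)
      map_smul' := fun b x => by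
        refine (DFunLike.congr_fun
          (?_ : (NCTensor.map _ _).comp (NCTensor.map _ _) =
            (NCTensor.map _ _).comp (NCTensor.map _ _)) x)
        exact NCTensor.addHom_ext fun m n => by simp }
  map_id N := by
    apply ModuleCat.hom_ext
    apply LinearMap.ext
    intro x
    exact DFunLike.congr_fun NCTensor.map_id x
  map_comp f g := by
    apply ModuleCat.hom_ext
    apply LinearMap.ext
    intro x
    exact DFunLike.congr_fun (NCTensor.map_comp f.hom g.hom LinearMap.id LinearMap.id) x

instance (M : AlgBimodule k A B) : M.tensorRightFunctor.Additive where
  map_add {N N' f g} := by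
    apply ModuleCat.hom_ext
    apply LinearMap.ext
    intro x
    exact DFunLike.congr_fun (NCTensor.map_add_left f.hom g.hom LinearMap.id) x

/-- The functor `N ↦ M ⊗_B N` from left `B`-modules to left `A`-modules. -/
def tensorLeftFunctor (M : AlgBimodule k A B) : ModuleCat.{u} B ⥤ ModuleCat.{u} A where
  obj N := M.tensorLeftObj N
  map {N N'} f := @ModuleCat.ofHom A _ (M.tensorLeftObj N) (M.tensorLeftObj N') _ _ _ _
    { toFun := NCTensor.map LinearMap.id f.hom
      map_add' := map_add (NCTensor.map LinearMap.id f.hom)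
      map_smul' := fun b x => by
        refine (DFunLike.congr_fun
          (?_ : (NCTensor.map _ _).comp (NCTensor.map _ _) =
            (NCTensor.map _ _).comp (NCTensor.map _ _)) x)
        exact NCTensor.addHom_ext fun m n => by simp }
  map_id N := by
    apply ModuleCat.hom_ext
    apply LinearMap.ext
    intro x
    exact DFunLike.congr_fun NCTensor.map_id x
  map_comp f g := by
    apply ModuleCat.hom_ext
    apply LinearMap.ext
    intro x
    exact DFunLike.congr_fun (NCTensor.map_comp LinearMap.id LinearMap.id f.hom g.hom) x

instance (M : AlgBimodule k A B) : M.tensorLeftFunctor.Additive where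
  map_add {N N' f g} := by
    apply ModuleCat.hom_ext
    apply LinearMap.ext
    intro x
    exact DFunLike.congr_fun (NCTensor.map_add_right LinearMap.id f.hom g.hom) x

/-- `Tor_j^A(N, M)` as a right `B`-module, for a right `A`-module `N`. -/
def torRight (M : AlgBimodule k A B) (j : ℕ) (N : ModuleCat.{u} Aᵐᵒᵖ) : ModuleCat.{u} Bᵐᵒᵖ :=
  (M.tensorRightFunctor.leftDerived j).obj N

/-- `Tor_j^B(M, N)` as a left `A`-module, for a left `B`-module `N`. -/
def torLeft (M : AlgBimodule k A B) (j : ℕ) (N : ModuleCat.{u} B) : ModuleCat.{u} A :=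
  (M.tensorLeftFunctor.leftDerived j).obj N

end AlgBimodule

/-! ### Standing hypotheses on the dimension function -/

namespace DimFunction

/-- `M` is a finitely generated `R`-module of dimension at most `n`. -/
def IsSmall (δ : DimFunction.{u}) (n : ℤ) (R : Type u) [Ring R] (M : ModuleCat.{u} R) : Prop :=
  Module.Finite R M ∧ δ R M ≤ ((n : ℝ) : EReal)

variable (k : Type v) [CommRing k] (A B : Type u) [Ring A] [Algebra k A] [Ring B] [Algebra k B]

/-- For `(A, B)`-bimodules that are finitely generated on one side, the dimension on the other side
is at most the dimension on that side. -/
def IsSymmetric (δ : DimFunction.{u}) : Prop :=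
  ∀ M : AlgBimodule k A B,
    (Module.Finite Bᵐᵒᵖ M → δ A M ≤ δ Bᵐᵒᵖ M) ∧ (Module.Finite A M → δ Bᵐᵒᵖ M ≤ δ A M)

/-- The condition `γ_{n,i}(A, B)`: for every `(A, B)`-bimodule `M` finitely generated on both
sides, `Tor_j(-, M)` and `Tor_j(M, -)`, `0 ≤ j ≤ i`, preserve finitely generated modules of
dimension at most `n`. -/
def SatisfiesGamma (δ : DimFunction.{u}) (n : ℤ) (i : ℕ) : Prop :=
  ∀ M : AlgBimodule k A B, M.IsFG →
    (∀ N : ModuleCat.{u} Aᵐᵒᵖ, δ.IsSmall n Aᵐᵒᵖ N →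
      ∀ j ≤ i, δ.IsSmall n Bᵐᵒᵖ (M.torRight j N)) ∧
    (∀ N : ModuleCat.{u} B, δ.IsSmall n B N →
      ∀ j ≤ i, δ.IsSmall n A (M.torLeft j N))

end DimFunction

/-! ### Homological conditions

In this part `D` carries commuting actions of `R` and `S`.  For an algebra `A` one takes `D = A`
with `(R, S) = (A, Aᵐᵒᵖ)` for left modules and `(R, S) = (Aᵐᵒᵖ, A)` for right modules. -/

section Homological

/-- `Ext^q_R(M, D)`. -/
def ExtMod (R D M : Type u) [Ring R] [AddCommGroup D] [Module R D] [AddCommGroup M] [Module R M]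
    (q : ℕ) : Type u :=
  Abelian.Ext.{u} (ModuleCat.of R M) (ModuleCat.of R D) q

variable (R S D M : Type u) [Ring R] [Ring S] [AddCommGroup D] [Module R D] [Module S D]
  [SMulCommClass S R D] [AddCommGroup M] [Module R M]

instance (q : ℕ) : AddCommGroup (ExtMod R D M q) :=
  inferInstanceAs (AddCommGroup (Abelian.Ext.{u} (ModuleCat.of R M) (ModuleCat.of R D) q))

/-- `Ext^q_R(M, D)` is an `S`-module through the functoriality of `Ext` in `D`. -/
instance (q : ℕ) : Module S (ExtMod R D M q) where
  smul s x := Abelian.Ext.comp (x : Abelian.Ext.{u} (ModuleCat.of R M) (ModuleCat.of R D) q)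
    (Abelian.Ext.mk₀ (ModuleCat.ofHom (DistribSMul.toLinearMap R D s))) (add_zero q)
  one_smul x := by
    refine Eq.trans ?_ (Abelian.Ext.comp_mk₀_id x)
    refine congrArg (fun f => Abelian.Ext.comp x (Abelian.Ext.mk₀ f) (add_zero q)) ?_
    ext y; simp
  mul_smul s t x := by
    refine Eq.trans ?_ (Abelian.Ext.comp_assoc x _ _ (add_zero q) (add_zero 0) (by simp)).symm
    refine congrArg (fun f => Abelian.Ext.comp x f (add_zero q)) ?_
    rw [Abelian.Ext.mk₀_comp_mk₀]
    congr 1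
    ext y; simp [mul_smul]
  smul_zero s := Abelian.Ext.zero_comp (X := ModuleCat.of R M) (Y := ModuleCat.of R D) q
    (Abelian.Ext.mk₀ (ModuleCat.ofHom (DistribSMul.toLinearMap R D s))) q (add_zero q)
  smul_add s x y := Abelian.Ext.add_comp _ _ _ _
  add_smul s t x := by
    refine Eq.trans ?_ (Abelian.Ext.comp_add x _ _ (add_zero q))
    refine congrArg (fun f => Abelian.Ext.comp x f (add_zero q)) ?_
    rw [← Abelian.Ext.mk₀_add]
    congr 1
    ext y; simp [add_smul]
  zero_smul x := by
    refine Eq.trans ?_ (Abelian.Ext.comp_zero x _ 0 q (add_zero q))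
    refine congrArg (fun f => Abelian.Ext.comp x f (add_zero q)) ?_
    rw [← Abelian.Ext.mk₀_zero]
    congr 1
    ext y; simp

/-- The grade number `inf {i | Ext^i_R(M, D) ≠ 0}`. -/
def gradeNumber (R D M : Type u) [Ring R] [AddCommGroup D] [Module R D] [AddCommGroup M]
    [Module R M] : ℕ∞ :=
  ⨅ (i : ℕ) (_ : Nontrivial (ExtMod R D M i)), (i : ℕ∞)

/-- The Auslander condition for the `R`-module `M`: every `S`-submodule of `Ext^q_R(M, D)` has
grade number at least `q`. -/
def AuslanderCondition : Prop :=
  ∀ (q : ℕ) (N : Submodule S (ExtMod R D M q)), (q : ℕ∞) ≤ gradeNumber S D N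

/-- The natural map from `M` to its double dual. -/
def toDoubleDual [SMulCommClass R S D] (m : M) : (M →ₗ[R] D) →ₗ[S] D where
  toFun φ := φ m
  map_add' _ _ := rfl
  map_smul' _ _ := rfl

/-- `M` is finitely generated and the natural map to its double dual is an isomorphism. -/
def IsReflexiveModule [SMulCommClass R S D] : Prop :=
  Module.Finite R M ∧ Function.Bijective (toDoubleDual R S D M)

end Homological

/-- Auslander-Gorenstein rings. -/
def IsAuslanderGorenstein (A : Type u) [Ring A] : Prop :=
  (∃ n : ℕ, injectiveDimension (ModuleCat.of A A) = n ∧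
    injectiveDimension (ModuleCat.of Aᵐᵒᵖ A) = n) ∧
  (∀ (M : Type u) [AddCommGroup M] [Module A M], Module.Finite A M →
    AuslanderCondition A Aᵐᵒᵖ A M) ∧
  (∀ (M : Type u) [AddCommGroup M] [Module Aᵐᵒᵖ M], Module.Finite Aᵐᵒᵖ M →
    AuslanderCondition Aᵐᵒᵖ A A M)

/-- `A` is Cohen-Macaulay with respect to `δ`, of dimension `d`: the left and the right module `A`
have dimension `d`, and grade number plus dimension is `d` for every nonzero finitely generated
left or right module. -/
def IsCohenMacaulayOfDim (δ : DimFunction.{u}) (A : Type u) [Ring A] (d : ℕ) : Prop :=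
  (δ A A = d ∧ δ Aᵐᵒᵖ A = d) ∧
  (∀ (M : Type u) [AddCommGroup M] [Module A M], Module.Finite A M → Nontrivial M →
    ((gradeNumber A A M : ENNReal) : EReal) + δ A M = d) ∧
  (∀ (M : Type u) [AddCommGroup M] [Module Aᵐᵒᵖ M], Module.Finite Aᵐᵒᵖ M → Nontrivial M →
    ((gradeNumber Aᵐᵒᵖ A M : ENNReal) : EReal) + δ Aᵐᵒᵖ M = d)

/-- The bimodule is finitely generated and reflexive both as a left and as a right module. -/
def AlgBimodule.IsReflexiveOnBothSides {k : Type v} [CommRing k] {A B : Type u} [Ring A]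
    [Algebra k A] [Ring B] [Algebra k B] (M : AlgBimodule k A B) : Prop :=
  IsReflexiveModule A Aᵐᵒᵖ A M ∧ IsReflexiveModule Bᵐᵒᵖ B B M

end

/-! Call a right module small if its dimension is at most `d - 2`. It suffices to find reflexive
bimodules `U`, `V` and bimodule maps `T → U`, `T' → V` with small kernel and cokernel: tensoring
preserves such maps (`Hom.IsNIso.tensor`), and a pushout transports the given comparison with `B₁`
or `B₂` (`NIsomorphic.of_isNIso`).

Let `N` be the largest right submodule of `T` of dimension at most `d - 1`. Then `U` is the right
double dual of `T/N`. The Auslander and Cohen–Macaulay conditions bound the evaluation map of a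
finitely generated module into its double dual: its kernel sits inside an `Ext¹`, its cokernel
inside an `Ext²`, so they have dimension at most `d - 1` and `d - 2` (`dim_ker_eval_le`,
`dim_coker_eval_le`). Since `T/N` is torsion-free, `T/N → U` is injective with small cokernel.

Right reflexivity of `U` is formal. For the left side, symmetry of the dimension carries the small
cokernel across, and a torsion-free extension with small cokernel of a finitely generated
torsion-free module embeds in a finite power of the ring, so `U` is finitely generated on the left
(`finite_of_extension`). Its evaluation into the left double dual is also a right linear map:
injective, with small cokernel and torsion-free target. A reflexive module has no proper extension
of that kind, so the map is bijective (`isReflexiveModule_otherSide`).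

It remains to see that `N` itself is small (`dim_torsion_le_of_nIsomorphic`), where invertibility is
used. Let `P` be the bimodule comparing `T ⊗ T'` with `B₁`, and `K` the kernel of `T ⊗ T' → (T/N) ⊗
T'`. As a left module, `K` is covered by a power of `N`, so it has left dimension at most `d - 1`
and its image in `P` meets `B₁` in zero. Hence `K` is small, being controlled by the small kernel of
`T ⊗ T' → P` and the small quotient `P/B₁`. Tensoring with `T` and replacing `T' ⊗ T` by `B₂` shows
that `T → T/N` has small kernel. -/

/-! ### Exact dimension functions -/

namespace DimFunction.IsExact

variable {δ : DimFunction.{u}} {R : Type u} [Ring R] (h : δ.IsExact R)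
variable {M N P : Type u} [AddCommGroup M] [Module R M] [AddCommGroup N] [Module R N]
  [AddCommGroup P] [Module R P] {e : EReal}

include h

theorem of_subsingleton [Subsingleton M] : δ R M ≤ e := by
  rw [(h.eq_bot_iff M).2 inferInstance]
  exact bot_le

theorem le_of_injective (f : M →ₗ[R] N) (hf : Function.Injective f) : δ R M ≤ δ R N := by
  rw [h.congr _ _ (LinearEquiv.ofInjective f hf)]
  exact (le_max_left _ _).trans (h.max_le N (LinearMap.range f))

theorem submodule_le (K : Submodule R M) : δ R K ≤ δ R M :=
  h.le_of_injective K.subtype K.injective_subtype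

theorem submodule_mono {K L : Submodule R M} (hKL : K ≤ L) : δ R K ≤ δ R L :=
  h.le_of_injective (Submodule.inclusion hKL) (Submodule.inclusion_injective hKL)

theorem quotient_le (K : Submodule R M) : δ R (M ⧸ K) ≤ δ R M :=
  (le_max_right _ _).trans (h.max_le M K)

theorem le_of_surjective (f : M →ₗ[R] N) (hf : Function.Surjective f) : δ R N ≤ δ R M := by
  rw [← h.congr _ _ (f.quotKerEquivOfSurjective hf)]
  exact h.quotient_le _

theorem range_le (f : M →ₗ[R] N) : δ R (LinearMap.range f) ≤ δ R M :=
  h.le_of_surjective f.rangeRestrict f.surjective_rangeRestrict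

theorem le_of_ker_range (f : M →ₗ[R] N) (hk : δ R (LinearMap.ker f) ≤ e)
    (hr : δ R (LinearMap.range f) ≤ e) : δ R M ≤ e := by
  rw [h.eq_max M (LinearMap.ker f), h.congr _ _ f.quotKerEquivRange]
  exact max_le hk hr

/-- `N` is a quotient of `M ⧸ ker q`, which is the range of `q`. This bounds a subquotient through
an auxiliary module `M`, without a map defined on `N` itself. -/
theorem le_of_ker_le (p : M →ₗ[R] N) (hp : Function.Surjective p) (q : M →ₗ[R] P)
    (hpq : LinearMap.ker q ≤ LinearMap.ker p) : δ R N ≤ δ R (LinearMap.range q) := by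
  rw [← h.congr _ _ q.quotKerEquivRange]
  refine h.le_of_surjective ((LinearMap.ker q).liftQ p hpq) fun n => ?_
  obtain ⟨m, rfl⟩ := hp n
  exact ⟨Submodule.Quotient.mk m, rfl⟩

theorem ker_le_of_comp (f : M →ₗ[R] N) (g : N →ₗ[R] P)
    (hgf : δ R (LinearMap.ker (g ∘ₗ f)) ≤ e) : δ R (LinearMap.ker f) ≤ e :=
  (h.submodule_mono (LinearMap.ker_le_ker_comp f g)).trans hgf

theorem ker_comp_le (f : M →ₗ[R] N) (g : N →ₗ[R] P) (hf : δ R (LinearMap.ker f) ≤ e)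
    (hg : δ R (LinearMap.ker g) ≤ e) : δ R (LinearMap.ker (g ∘ₗ f)) ≤ e := by
  refine h.le_of_ker_range (f ∘ₗ (LinearMap.ker (g ∘ₗ f)).subtype) ?_ ?_
  · refine (h.le_of_injective (((LinearMap.ker (g ∘ₗ f)).subtype ∘ₗ
      (LinearMap.ker (f ∘ₗ (LinearMap.ker (g ∘ₗ f)).subtype)).subtype).codRestrict
        (LinearMap.ker f) fun x => x.2) ?_).trans hf
    intro x y hxy
    have hval := congrArg Subtype.val hxy
    exact Subtype.ext (Subtype.ext hval)
  · refine (h.submodule_mono ?_).trans hg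
    rintro _ ⟨x, rfl⟩
    exact x.2

/-- The cokernel of the composite maps onto that of `g`, and the kernel of this projection is an
image of the cokernel of `f`. -/
theorem coker_comp_le (f : M →ₗ[R] N) (g : N →ₗ[R] P) (hf : δ R (N ⧸ LinearMap.range f) ≤ e)
    (hg : δ R (P ⧸ LinearMap.range g) ≤ e) : δ R (P ⧸ LinearMap.range (g ∘ₗ f)) ≤ e := by
  have hle : LinearMap.range (g ∘ₗ f) ≤ LinearMap.range g := LinearMap.range_comp_le_range f g
  have hc : LinearMap.range f ≤ (LinearMap.range (g ∘ₗ f)).comap g := by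
    rintro _ ⟨x, rfl⟩
    exact ⟨x, rfl⟩
  refine h.le_of_ker_range (Submodule.factor hle) ?_ ((h.submodule_le _).trans hg)
  refine (h.submodule_mono (L := LinearMap.range (Submodule.mapQ _ _ g hc)) ?_).trans
    ((h.range_le _).trans hf)
  intro x hx
  obtain ⟨x, rfl⟩ := Submodule.Quotient.mk_surjective _ x
  obtain ⟨n, rfl⟩ : x ∈ LinearMap.range g := (Submodule.Quotient.mk_eq_zero _).1 hx
  exact ⟨Submodule.Quotient.mk n, rfl⟩

/-- The part of `ker g` inside the range of `f` is the image of `ker (g ∘ₗ f)`; the rest embeds in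
the cokernel of `f`. -/
theorem ker_le_of_comp_of_coker (f : M →ₗ[R] N) (g : N →ₗ[R] P)
    (hf : δ R (N ⧸ LinearMap.range f) ≤ e) (hgf : δ R (LinearMap.ker (g ∘ₗ f)) ≤ e) :
    δ R (LinearMap.ker g) ≤ e := by
  refine h.le_of_ker_range ((LinearMap.range f).mkQ ∘ₗ (LinearMap.ker g).subtype) ?_
    ((h.submodule_le _).trans hf)
  refine (h.le_of_injective (N := (LinearMap.ker (g ∘ₗ f)).map f)
    (((LinearMap.ker g).subtype ∘ₗ (LinearMap.ker ((LinearMap.range f).mkQ ∘ₗ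
      (LinearMap.ker g).subtype)).subtype).codRestrict _ ?_) ?_).trans
    ((h.le_of_surjective (f.submoduleMap _) (f.submoduleMap_surjective _)).trans hgf)
  · rintro ⟨⟨x, hx⟩, hx'⟩
    obtain ⟨m, rfl⟩ : x ∈ LinearMap.range f := (Submodule.Quotient.mk_eq_zero _).1 hx'
    exact ⟨m, hx, rfl⟩
  · intro x y hxy
    have hval := congrArg Subtype.val hxy
    exact Subtype.ext (Subtype.ext hval)

theorem pi_le (hM : δ R M ≤ e) (n : ℕ) : δ R (Fin n → M) ≤ e := by
  induction n with
  | zero => exact h.of_subsingleton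
  | succ n ih =>
    refine h.le_of_ker_range (LinearMap.proj (0 : Fin (n + 1))) ?_ ((h.submodule_le _).trans hM)
    refine (h.le_of_injective ((LinearMap.funLeft R M (Fin.succ : Fin n → Fin (n + 1))) ∘ₗ
      (LinearMap.ker (LinearMap.proj (0 : Fin (n + 1)))).subtype) ?_).trans ih
    intro x y hxy
    ext i
    refine Fin.cases ?_ (fun j => congrFun hxy j) i
    rw [show x.1 0 = 0 from x.2, show y.1 0 = 0 from y.2]

theorem sup_le {K L : Submodule R M} (hK : δ R K ≤ e) (hL : δ R L ≤ e) :
    δ R (K ⊔ L : Submodule R M) ≤ e := by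
  have hsurj : ∀ x : (K ⊔ L : Submodule R M), ∃ y : K × L, (y.1 : M) + y.2 = x := by
    rintro ⟨x, hx⟩
    obtain ⟨a, ha, b, hb, rfl⟩ := Submodule.mem_sup.1 hx
    exact ⟨(⟨a, ha⟩, ⟨b, hb⟩), rfl⟩
  refine (h.le_of_surjective ((K.subtype.coprod L.subtype).codRestrict (K ⊔ L) fun y =>
    add_mem (Submodule.mem_sup_left y.1.2) (Submodule.mem_sup_right y.2.2)) fun x => ?_).trans
    (h.le_of_ker_range (LinearMap.fst R K L) ?_ ((h.submodule_le _).trans hK))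
  · obtain ⟨y, hy⟩ := hsurj x
    exact ⟨y, Subtype.ext hy⟩
  · refine (h.le_of_injective (LinearMap.snd R K L ∘ₗ
      (LinearMap.ker (LinearMap.fst R K L)).subtype) ?_).trans hL
    rintro ⟨⟨a, b⟩, hx⟩ ⟨⟨a', b'⟩, hy⟩ hxy
    obtain rfl : a = 0 := hx
    obtain rfl : a' = 0 := hy
    obtain rfl : b = b' := hxy
    rfl

end DimFunction.IsExact

/-! ### Torsion submodules and torsion-free modules. -/

namespace DimFunction

variable (δ : DimFunction.{u}) (e : EReal) (R : Type u) [Ring R] (M : Type u) [AddCommGroup M]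
  [Module R M]

/-- The sum of all submodules of dimension at most `e`. -/
def torsion : Submodule R M := sSup {N | δ R N ≤ e}

/-- Every submodule of dimension at most `e` vanishes. -/
def TorsionFree : Prop := ∀ N : Submodule R M, δ R N ≤ e → N = ⊥

variable {δ e R M}

theorem le_torsion {N : Submodule R M} (hN : δ R N ≤ e) : N ≤ torsion δ e R M :=
  le_sSup hN

/-- Submodules of dimension at most `e` are closed under binary sums, so they form a directed family
and the dimension passes to the union. No finiteness is needed, which matters for modules not yet
known to be finitely generated. -/
theorem IsExact.torsion_le (h : δ.IsExact R) : δ R (torsion δ e R M) ≤ e := by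
  rw [torsion, h.sSup_directed]
  · exact iSup₂_le fun N hN => hN
  · exact ⟨⊥, h.of_subsingleton⟩
  · exact fun K hK L hL => ⟨K ⊔ L, h.sup_le hK hL, le_sup_left, le_sup_right⟩

/-- Applied to multiplication by a commuting ring, this makes the torsion of a bimodule a
sub-bimodule. -/
theorem IsExact.map_mem_torsion (h : δ.IsExact R) {N : Type u} [AddCommGroup N] [Module R N]
    (φ : M →ₗ[R] N) {m : M} (hm : m ∈ torsion δ e R M) : φ m ∈ torsion δ e R N := by
  refine le_torsion (N := (torsion δ e R M).map φ) ?_ ⟨m, hm, rfl⟩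
  exact (h.le_of_surjective (φ.submoduleMap _) (φ.submoduleMap_surjective _)).trans h.torsion_le

theorem IsExact.torsionFree_quotient (h : δ.IsExact R) :
    TorsionFree δ e R (M ⧸ torsion δ e R M) := by
  intro N hN
  have hle : N.comap (torsion δ e R M).mkQ ≤ torsion δ e R M := by
    refine le_torsion (h.le_of_ker_range ((torsion δ e R M).mkQ ∘ₗ
      (N.comap (torsion δ e R M).mkQ).subtype) ?_ ?_)
    · refine (h.le_of_injective (((N.comap (torsion δ e R M).mkQ).subtype ∘ₗ
        (LinearMap.ker ((torsion δ e R M).mkQ ∘ₗ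
          (N.comap (torsion δ e R M).mkQ).subtype)).subtype).codRestrict
          (torsion δ e R M) ?_) ?_).trans h.torsion_le
      · exact fun x => (Submodule.Quotient.mk_eq_zero _).1 x.2
      · intro x y hxy
        have hval := congrArg Subtype.val hxy
        exact Subtype.ext (Subtype.ext hval)
    · refine (h.submodule_mono ?_).trans hN
      rintro _ ⟨x, rfl⟩
      exact x.2
  rw [eq_bot_iff]
  intro x hx
  obtain ⟨x, rfl⟩ := Submodule.Quotient.mk_surjective _ x
  exact (Submodule.Quotient.mk_eq_zero _).2 (hle hx)

theorem TorsionFree.eq_bot_of_torsion (htf : torsion δ e R M = ⊥) : TorsionFree δ e R M :=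
  fun _ hN => eq_bot_iff.2 (htf ▸ le_torsion hN)

theorem TorsionFree.of_injective (h : δ.IsExact R) {N : Type u} [AddCommGroup N] [Module R N]
    (htf : TorsionFree δ e R N) (f : M →ₗ[R] N) (hf : Function.Injective f) :
    TorsionFree δ e R M := by
  intro K hK
  have := htf (K.map f) ((h.le_of_surjective (f.submoduleMap _)
    (f.submoduleMap_surjective _)).trans hK)
  exact Submodule.map_injective_of_injective hf (this.trans (Submodule.map_bot f).symm)

end DimFunction

/-! ### Connecting maps for `Ext` into a bimodule -/

section Connecting

open Abelian

variable {R S D : Type u} [Ring R] [Ring S] [AddCommGroup D] [Module R D] [Module S D]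
  [SMulCommClass R S D]
variable {X Y Z : Type u} [AddCommGroup X] [Module S X] [AddCommGroup Y] [Module S Y]
  [AddCommGroup Z] [Module S Z]

theorem shortExact_moduleCat {f : X →ₗ[S] Y} {g : Y →ₗ[S] Z} (hf : Function.Injective f)
    (hfg : Function.Exact f g) (hg : Function.Surjective g) :
    (ShortComplex.mk (ModuleCat.ofHom f) (ModuleCat.ofHom g) (by
      ext x; exact hfg.apply_apply_eq_zero x)).ShortExact where
  exact := (ShortComplex.ShortExact.moduleCat_exact_iff_function_exact _).2 hfg
  mono_f := (ModuleCat.mono_iff_injective _).2 hf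
  epi_g := (ModuleCat.epi_iff_surjective _).2 hg

/-- The identification of linear maps with `Ext` in degree zero. -/
noncomputable def homToExtMod (R S D X : Type u) [Ring R] [Ring S] [AddCommGroup D] [Module R D]
    [Module S D] [SMulCommClass R S D] [SMulCommClass S R D] [AddCommGroup X] [Module S X] :
    (X →ₗ[S] D) →ₗ[R] ExtMod S D X 0 where
  toFun f := Ext.mk₀ (ModuleCat.ofHom f)
  map_add' _ _ := Ext.mk₀_add _ _
  map_smul' r f := (Ext.mk₀_comp_mk₀ (ModuleCat.ofHom f)
    (ModuleCat.ofHom (DistribSMul.toLinearMap S D r))).symm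

theorem homToExtMod_bijective [SMulCommClass S R D] :
    Function.Bijective (homToExtMod R S D X) := by
  have := (Ext.homEquiv₀ (X := ModuleCat.of S X) (Y := ModuleCat.of S D)).symm.bijective.comp
    (ModuleCat.homEquiv (M := ModuleCat.of S X) (N := ModuleCat.of S D)).symm.bijective
  exact this

/-- The connecting map of a short exact sequence, as a linear map for the action on the
coefficients. -/
noncomputable def extModConnecting (R D : Type u) [Ring R] [AddCommGroup D] [Module R D]
    [Module S D] [SMulCommClass R S D] {f : X →ₗ[S] Y} {g : Y →ₗ[S] Z}
    (hf : Function.Injective f)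
    (hfg : Function.Exact f g) (hg : Function.Surjective g) (q : ℕ) :
    ExtMod S D X q →ₗ[R] ExtMod S D Z (q + 1) where
  toFun x := Ext.comp (shortExact_moduleCat hf hfg hg).extClass
    (x : Ext.{u} (ModuleCat.of S X) (ModuleCat.of S D) q) (add_comm 1 q)
  map_add' _ _ := Ext.comp_add _ _ _ _
  map_smul' r x :=
    (Ext.comp_assoc (shortExact_moduleCat hf hfg hg).extClass
      (x : Ext.{u} (ModuleCat.of S X) (ModuleCat.of S D) q)
      (Ext.mk₀ (ModuleCat.ofHom (DistribSMul.toLinearMap S D r))) (add_comm 1 q) (add_zero q)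
      (by omega)).symm

/-- The connecting map is the obstruction to extension in the long exact `Ext` sequence. -/
theorem exists_extension_of_connecting_eq_zero [SMulCommClass S R D]
    {f : X →ₗ[S] Y} {g : Y →ₗ[S] Z}
    (hf : Function.Injective f) (hfg : Function.Exact f g) (hg : Function.Surjective g)
    (φ : X →ₗ[S] D) (hφ : extModConnecting R D hf hfg hg 0 (homToExtMod R S D X φ) = 0) :
    ∃ ψ : Y →ₗ[S] D, ψ ∘ₗ f = φ := by
  obtain ⟨x, hx⟩ := Ext.contravariant_sequence_exact₁ (shortExact_moduleCat hf hfg hg)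
    (ModuleCat.of S D) (Ext.mk₀ (ModuleCat.ofHom φ)) (add_comm 1 0) hφ
  obtain ⟨ψ, rfl⟩ := (homToExtMod_bijective (R := R) (S := S) (D := D) (X := Y)).2 x
  refine ⟨ψ, (homToExtMod_bijective (R := R) (S := S) (D := D) (X := X)).1 ?_⟩
  exact (Ext.mk₀_comp_mk₀ (ModuleCat.ofHom f) (ModuleCat.ofHom ψ)).symm.trans hx

theorem exists_extension_of_subsingleton_ext [SMulCommClass S R D]
    {f : X →ₗ[S] Y} {g : Y →ₗ[S] Z}
    (hf : Function.Injective f) (hfg : Function.Exact f g) (hg : Function.Surjective g)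
    (hZ : Subsingleton (ExtMod S D Z 1)) (φ : X →ₗ[S] D) :
    ∃ ψ : Y →ₗ[S] D, ψ ∘ₗ f = φ :=
  exists_extension_of_connecting_eq_zero (R := R) hf hfg hg φ (Subsingleton.elim _ _)

/-- Dimension shifting: the preceding term `Ext¹(Y, D)` vanishes. -/
theorem extModConnecting_one_injective [Module.Projective S Y] {f : X →ₗ[S] Y} {g : Y →ₗ[S] Z}
    (hf : Function.Injective f) (hfg : Function.Exact f g) (hg : Function.Surjective g) :
    Function.Injective (extModConnecting R D hf hfg hg 1) := by
  rw [injective_iff_map_eq_zero]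
  intro x hx
  obtain ⟨y, hy⟩ := Ext.contravariant_sequence_exact₁ (shortExact_moduleCat hf hfg hg)
    (ModuleCat.of S D) (x : Ext.{u} (ModuleCat.of S X) (ModuleCat.of S D) 1) (add_comm 1 1) hx
  have : Projective (ModuleCat.of S Y) := (IsProjective.iff_projective Y).1 inferInstance
  rw [Ext.eq_zero_of_projective y, Ext.comp_zero] at hy
  exact hy.symm

theorem extMod_subsingleton_of_subsingleton [Subsingleton X] (q : ℕ) :
    Subsingleton (ExtMod S D X q) := by
  refine ⟨fun x y => ?_⟩
  have hX : Limits.IsZero (ModuleCat.of S X) := ModuleCat.isZero_of_subsingleton _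
  have key : ∀ x : Ext.{u} (ModuleCat.of S X) (ModuleCat.of S D) q, x = 0 := fun x => by
    rw [← Ext.mk₀_id_comp x, hX.eq_of_src (𝟙 _) 0, Ext.mk₀_zero, Ext.zero_comp]
  exact (key x).trans (key y).symm

end Connecting

/-! ### Grade numbers and dimension -/

namespace DimFunction

/-- The extended real number `d - q`. -/
def codim (d q : ℕ) : EReal := ((((d : ℤ) - (q : ℤ) : ℤ) : ℝ) : EReal)

theorem coe_toENNReal_natCast (j : ℕ) :
    ((((j : ℕ∞) : ENNReal)) : EReal) = ((j : ℝ) : EReal) := by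
  rw [ENat.toENNReal_coe]
  exact EReal.coe_nnreal_eq_coe_real (j : NNReal)

theorem codim_anti (d : ℕ) {p q : ℕ} (hpq : p ≤ q) : codim d q ≤ codim d p := by
  refine EReal.coe_le_coe_iff.2 (Int.cast_le.2 ?_)
  omega

/-- Consequences of the Auslander-Gorenstein and the Cohen-Macaulay condition, for one side of a
ring.  Here `D` is the ring itself, with one of its two actions as `R`-action and the other one as
`S`-action. -/
structure IsDualizing (δ : DimFunction.{u}) (d : ℕ) (R S D : Type u) [Ring R] [Ring S]
    [AddCommGroup D] [Module R D] [Module S D] [SMulCommClass R S D] [SMulCommClass S R D] :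
    Prop where
  exact : δ.IsExact R
  noeth_left : IsNoetherianRing R
  noeth_right : IsNoetherianRing S
  finite_left : Module.Finite R D
  finite_right : Module.Finite S D
  free_right : Module.Free S D
  eq_smul : ∀ f : D →ₗ[S] D, ∃ r : R, ∀ x, f x = r • x
  eq_zero_of_smul : ∀ r : R, (∀ x : D, r • x = 0) → r = 0
  grade_add_dim : ∀ (M : Type u) [AddCommGroup M] [Module R M], Module.Finite R M →
    Nontrivial M → ((gradeNumber R D M : ENNReal) : EReal) + δ R M = d
  auslander : ∀ (M : Type u) [AddCommGroup M] [Module S M], Module.Finite S M →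
    AuslanderCondition S R D M

namespace IsDualizing

variable {δ : DimFunction.{u}} {d : ℕ} {R S D : Type u} [Ring R] [Ring S]
    [AddCommGroup D] [Module R D] [Module S D] [SMulCommClass R S D] [SMulCommClass S R D]
    (h : δ.IsDualizing d R S D)
variable {M : Type u} [AddCommGroup M] [Module R M]

include h

/-- The Cohen–Macaulay identity turns grade at least `q` into dimension at most `d - q`; a value `⊤`
of either summand is excluded because the sum is `d`. The next lemma is the converse direction. -/
theorem dim_le [Module.Finite R M] {q : ℕ} (hq : (q : ℕ∞) ≤ gradeNumber R D M) :
    δ R M ≤ codim d q := by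
  rcases subsingleton_or_nontrivial M with hM | hM
  · exact h.exact.of_subsingleton
  have hsum := h.grade_add_dim M inferInstance hM
  generalize gradeNumber R D M = j at hq hsum
  generalize δ R M = x at hsum ⊢
  induction x with
  | bot => exact bot_le
  | top =>
    rw [EReal.add_top_of_ne_bot (by simp)] at hsum
    exact absurd hsum.symm (EReal.natCast_ne_top d)
  | coe x =>
    induction j with
    | top =>
      simp only [ENat.toENNReal_top, EReal.coe_ennreal_top, EReal.top_add_coe] at hsum
      exact absurd hsum.symm (EReal.natCast_ne_top d)
    | coe j =>
      have hsum' : ((j : ℝ) + x : ℝ) = (d : ℝ) := by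
        have : (((j : ℝ) + x : ℝ) : EReal) = ((d : ℝ) : EReal) := by
          rw [EReal.coe_add]
          rwa [coe_toENNReal_natCast] at hsum
        exact_mod_cast this
      have hq' : (q : ℝ) ≤ j := by exact_mod_cast hq
      refine EReal.coe_le_coe_iff.2 ?_
      push_cast
      linarith

theorem subsingleton_ext [Module.Finite R M] {q i : ℕ} (hM : δ R M ≤ codim d q) (hi : i < q) :
    Subsingleton (ExtMod R D M i) := by
  rcases subsingleton_or_nontrivial M with hs | hs
  · exact extMod_subsingleton_of_subsingleton i
  have hsum := h.grade_add_dim M inferInstance hs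
  by_contra hne
  rw [not_subsingleton_iff_nontrivial] at hne
  have hj : gradeNumber R D M ≤ i := iInf₂_le i hne
  generalize gradeNumber R D M = j at hj hsum
  generalize δ R M = x at hsum hM
  have hjtop : j ≠ ⊤ := ne_top_of_le_ne_top (ENat.natCast_ne_top i) hj
  lift j to ℕ using hjtop
  induction x with
  | bot =>
    rw [EReal.add_bot] at hsum
    exact EReal.natCast_ne_bot d hsum.symm
  | top => exact absurd hM (not_le.2 (EReal.coe_lt_top _))
  | coe x =>
    have hsum' : ((j : ℝ) + x : ℝ) = (d : ℝ) := by
      have : (((j : ℝ) + x : ℝ) : EReal) = ((d : ℝ) : EReal) := by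
        rw [EReal.coe_add]
        rwa [coe_toENNReal_natCast] at hsum
      exact_mod_cast this
    have hM' := EReal.coe_le_coe_iff.1 hM
    push_cast at hM'
    have hj' : (j : ℝ) ≤ i := by exact_mod_cast hj
    have hi' : (i : ℝ) < q := by exact_mod_cast hi
    linarith

theorem hom_eq_zero [Module.Finite R M] (hM : δ R M ≤ codim d 1) (f : M →ₗ[R] D) : f = 0 := by
  have := h.subsingleton_ext hM zero_lt_one
  exact (homToExtMod_bijective (R := S) (S := R)).1 (Subsingleton.elim _ _)

theorem exists_extension {N : Type u} [AddCommGroup N] [Module R N] (i : M →ₗ[R] N)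
    (hi : Function.Injective i) (hfin : Module.Finite R (N ⧸ LinearMap.range i))
    (hN : δ R (N ⧸ LinearMap.range i) ≤ codim d 2) (f : M →ₗ[R] D) :
    ∃ g : N →ₗ[R] D, g ∘ₗ i = f :=
  exists_extension_of_subsingleton_ext (R := S) hi
    (LinearMap.exact_map_mkQ_range i) (Submodule.mkQ_surjective _)
    (h.subsingleton_ext hN one_lt_two) f

/-- The entry point of the Auslander condition: a module that is detected by a map into `Ext^q` has
codimension at least `q`. -/
theorem dim_range_ext_le {N : Type u} [AddCommGroup N] [Module S N] [Module.Finite S N]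
    [Module.Finite R M] {q : ℕ} (c : M →ₗ[R] ExtMod S D N q) :
    δ R (LinearMap.range c) ≤ codim d q :=
  h.dim_le (h.auslander N inferInstance q (LinearMap.range c))

end IsDualizing

end DimFunction

/-! ### Duals and double duals -/

section DoubleDual

variable (R S D M : Type u) [Ring R] [Ring S] [AddCommGroup D] [Module R D] [Module S D]
  [SMulCommClass R S D] [SMulCommClass S R D] [AddCommGroup M] [Module R M]

/-- The double dual of an `R`-module with respect to the bimodule `D`. -/
def DoubleDual : Type u := (M →ₗ[R] D) →ₗ[S] D

namespace DoubleDual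

instance : AddCommGroup (DoubleDual R S D M) :=
  inferInstanceAs (AddCommGroup ((M →ₗ[R] D) →ₗ[S] D))

instance : Module R (DoubleDual R S D M) :=
  inferInstanceAs (Module R ((M →ₗ[R] D) →ₗ[S] D))

variable {R S D M}

/-- An element of the double dual, as a linear map. -/
def toHom (F : DoubleDual R S D M) : (M →ₗ[R] D) →ₗ[S] D := F

@[ext]
theorem ext {F G : DoubleDual R S D M} (hFG : ∀ φ, F.toHom φ = G.toHom φ) : F = G :=
  LinearMap.ext (f := F.toHom) (g := G.toHom) hFG

@[simp] theorem toHom_smul (r : R) (F : DoubleDual R S D M) (φ : M →ₗ[R] D) :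
    (r • F).toHom φ = r • F.toHom φ := rfl

@[simp] theorem toHom_zero (φ : M →ₗ[R] D) : (0 : DoubleDual R S D M).toHom φ = 0 := rfl

variable (R S D M) in
/-- The natural map to the double dual. -/
def eval : M →ₗ[R] DoubleDual R S D M where
  toFun := toDoubleDual R S D M
  map_add' m n := ext fun φ => map_add φ m n
  map_smul' r m := ext fun φ => map_smul φ r m

@[simp] theorem eval_toHom (m : M) (φ : M →ₗ[R] D) : (eval R S D M m).toHom φ = φ m := rfl

/-- Evaluation at a functional. -/
def apply (φ : M →ₗ[R] D) : DoubleDual R S D M →ₗ[R] D where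
  toFun F := F.toHom φ
  map_add' _ _ := rfl
  map_smul' _ _ := rfl

section Action

variable (Q : Type u) [Ring Q] [Module Q M] [SMulCommClass Q R M]

/-- The action on the double dual induced by an action on the module. -/
instance action : Module Q (DoubleDual R S D M) where
  smul q F := F.toHom ∘ₗ (LinearMap.lcomp S D (DistribSMul.toLinearMap R M q) :
    (M →ₗ[R] D) →ₗ[S] (M →ₗ[R] D))
  one_smul F := ext fun φ => congrArg F.toHom (LinearMap.ext fun m => by simp)
  mul_smul q q' F := ext fun φ => congrArg F.toHom (LinearMap.ext fun m => by simp [mul_smul])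
  smul_zero q := rfl
  smul_add q F G := rfl
  add_smul q q' F := ext fun φ => (congrArg F.toHom (LinearMap.ext fun m => by
    simp [add_smul])).trans (map_add F.toHom _ _)
  zero_smul F := ext fun φ => (congrArg F.toHom (LinearMap.ext fun m => by
    simp)).trans (map_zero F.toHom)

variable {Q}

theorem action_toHom (q : Q) (F : DoubleDual R S D M) (φ : M →ₗ[R] D) :
    (q • F).toHom φ = F.toHom (φ ∘ₗ DistribSMul.toLinearMap R M q) := rfl

instance : SMulCommClass Q R (DoubleDual R S D M) := ⟨fun _ _ _ => rfl⟩

end Action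

end DoubleDual

end DoubleDual

section Finite

variable {R S D M : Type u} [Ring R] [Ring S] [AddCommGroup D] [Module R D] [Module S D]
  [SMulCommClass R S D] [AddCommGroup M] [Module R M]

theorem finite_linearMap [IsNoetherianRing S] [Module.Finite S D] [Module.Finite R M] :
    Module.Finite S (M →ₗ[R] D) := by
  obtain ⟨n, f, hf⟩ := Module.Finite.exists_fin' R M
  let g : (M →ₗ[R] D) →ₗ[S] (Fin n → D) :=
    { toFun := fun φ i => φ (f (Pi.single i 1))
      map_add' := fun _ _ => rfl
      map_smul' := fun _ _ => rfl }
  have hg : Function.Injective g := by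
    intro φ ψ hφψ
    have : φ ∘ₗ f = ψ ∘ₗ f := LinearMap.pi_ext' fun i => LinearMap.ext_ring (congrFun hφψ i)
    ext m
    obtain ⟨x, rfl⟩ := hf m
    exact LinearMap.congr_fun this x
  have : IsNoetherian S D := isNoetherian_of_isNoetherianRing_of_finite S D
  exact Module.Finite.of_injective g hg

end Finite

/-! ### Kernel and cokernel of evaluation, computed from a presentation. -/

namespace DimFunction.IsDualizing

open DoubleDual

variable {δ : DimFunction.{u}} {d : ℕ} {R S D : Type u} [Ring R] [Ring S]
    [AddCommGroup D] [Module R D] [Module S D] [SMulCommClass R S D] [SMulCommClass S R D]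
    (h : δ.IsDualizing d R S D)
variable {M : Type u} [AddCommGroup M] [Module R M]

/-- A linear map between powers of `D` given by a matrix over `R`. -/
def matrixMap (S D : Type u) [Ring S] [AddCommGroup D] [Module R D] [Module S D]
    [SMulCommClass R S D] {n m : ℕ} (ρ : Fin m → Fin n → R) : (Fin n → D) →ₗ[S] (Fin m → D) :=
  LinearMap.pi fun i => ∑ j, DistribSMul.toLinearMap S D (ρ i j) ∘ₗ LinearMap.proj j

@[simp] theorem matrixMap_apply {n m : ℕ} (ρ : Fin m → Fin n → R) (c : Fin n → D) (i : Fin m) :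
    matrixMap S D ρ c i = ∑ j, ρ i j • c j := by
  simp [matrixMap]

theorem finrepr_map {n : ℕ} (π : (Fin n → R) →ₗ[R] M) (φ : M →ₗ[R] D) (r : Fin n → R) :
    φ (π r) = ∑ j, r j • φ (π (Pi.single j 1)) := by
  conv_lhs => rw [pi_eq_sum_univ' r]
  simp [map_sum, map_smul]

/-- The dual of a module with generators `π`, in coordinates. -/
def dualCoord (S D : Type u) [Ring S] [AddCommGroup D] [Module R D] [Module S D]
    [SMulCommClass R S D] {n : ℕ} (π : (Fin n → R) →ₗ[R] M) : (M →ₗ[R] D) →ₗ[S] (Fin n → D) where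
  toFun φ j := φ (π (Pi.single j 1))
  map_add' _ _ := rfl
  map_smul' _ _ := rfl

theorem dualCoord_injective {n : ℕ} (π : (Fin n → R) →ₗ[R] M) (hπ : Function.Surjective π) :
    Function.Injective (dualCoord S D π) := by
  intro φ ψ hφψ
  ext m
  obtain ⟨r, rfl⟩ := hπ m
  rw [finrepr_map, finrepr_map]
  exact Finset.sum_congr rfl fun j _ => congrArg (r j • ·) (congrFun hφψ j)

/-- Left exactness of `Hom(-, D)` on the presentation with relations `ρ`: a tuple in `D^n` is a
functional on `M` exactly when it satisfies the relations. -/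
theorem dualCoord_exact {n m : ℕ} (π : (Fin n → R) →ₗ[R] M) (hπ : Function.Surjective π)
    (ρ : Fin m → Fin n → R) (hρ : Submodule.span R (Set.range ρ) = LinearMap.ker π) :
    Function.Exact (dualCoord S D π) (matrixMap S D ρ) := by
  intro c
  constructor
  · intro hc
    let ψ : (Fin n → R) →ₗ[R] D := ∑ j, (LinearMap.proj j : (Fin n → R) →ₗ[R] R).smulRight (c j)
    have hψ : ∀ r, ψ r = ∑ j, r j • c j := fun r => by simp [ψ]
    have hker : LinearMap.ker π ≤ LinearMap.ker ψ := by
      rw [← hρ, Submodule.span_le]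
      rintro _ ⟨i, rfl⟩
      rw [SetLike.mem_coe, LinearMap.mem_ker, hψ]
      simpa using congrFun hc i
    refine ⟨(LinearMap.ker π).liftQ ψ hker ∘ₗ (π.quotKerEquivOfSurjective hπ).symm.toLinearMap, ?_⟩
    ext j
    have : (π.quotKerEquivOfSurjective hπ).symm (π (Pi.single j 1)) =
        Submodule.Quotient.mk (Pi.single j 1) := by
      rw [LinearEquiv.symm_apply_eq]
      rfl
    change (LinearMap.ker π).liftQ ψ hker ((π.quotKerEquivOfSurjective hπ).symm
      (π (Pi.single j 1))) = c j
    rw [this, Submodule.liftQ_apply, hψ]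
    simp [Pi.single_apply]
  · rintro ⟨φ, rfl⟩
    ext i
    rw [matrixMap_apply]
    have hmem : ρ i ∈ LinearMap.ker π := hρ ▸ Submodule.subset_span ⟨i, rfl⟩
    have := finrepr_map π φ (ρ i)
    rw [LinearMap.mem_ker.1 hmem, map_zero] at this
    exact this.symm

include h

/-- Works coordinatewise because every `S`-endomorphism of `D` is multiplication by an element of
`R`; `coeff_ext` gives uniqueness of the coefficients. -/
theorem exists_coeff {n : ℕ} (f : (Fin n → D) →ₗ[S] D) :
    ∃ r : Fin n → R, ∀ c, f c = ∑ j, r j • c j := by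
  choose r hr using fun j => h.eq_smul (f ∘ₗ LinearMap.single S (fun _ => D) j)
  refine ⟨r, fun c => ?_⟩
  conv_lhs => rw [← Finset.univ_sum_single c]
  rw [map_sum]
  exact Finset.sum_congr rfl fun j _ => hr j (c j)

theorem coeff_ext {n : ℕ} {r s : Fin n → R}
    (hrs : ∀ c : Fin n → D, ∑ j, r j • c j = ∑ j, s j • c j) : r = s := by
  ext j
  rw [← sub_eq_zero]
  refine h.eq_zero_of_smul _ fun x => ?_
  have := hrs (Pi.single j x)
  simp only [Pi.single_apply, smul_ite, smul_zero, Finset.sum_ite_eq', Finset.mem_univ,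
    if_true] at this
  rw [sub_smul, this, sub_self]

theorem exists_presentation (M : Type u) [AddCommGroup M] [Module R M] [Module.Finite R M] :
    ∃ (n m : ℕ) (π : (Fin n → R) →ₗ[R] M) (ρ : Fin m → Fin n → R),
      Function.Surjective π ∧ Submodule.span R (Set.range ρ) = LinearMap.ker π := by
  have := h.noeth_left
  obtain ⟨n, π, hπ⟩ := Module.Finite.exists_fin' R M
  obtain ⟨m, ρ, hρ⟩ := Submodule.fg_iff_exists_fin_generating_family.1
    (IsNoetherian.noetherian (LinearMap.ker π))
  exact ⟨n, m, π, ρ, hπ, hρ⟩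

theorem finite_doubleDual [Module.Finite R M] : Module.Finite R (DoubleDual R S D M) := by
  have := h.noeth_left
  have := h.noeth_right
  have := h.finite_left
  have := h.finite_right
  have : Module.Finite S (M →ₗ[R] D) := finite_linearMap
  exact (finite_linearMap : Module.Finite R ((M →ₗ[R] D) →ₗ[S] D))

/-- Let `I` be the image of `Φ : D^n → D^m`. An element of the double dual that extends from `M*` to
`D^n` has coefficients `r`, so it is evaluation at `π r`. The obstruction lies in `Ext¹(I, D)`,
which embeds in `Ext²(D^m/I, D)` since `D^m` is projective over `S`. -/
theorem dim_coker_eval_le [Module.Finite R M] :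
    δ R (DoubleDual R S D M ⧸ LinearMap.range (eval R S D M)) ≤ codim d 2 := by
  obtain ⟨n, m, π, ρ, hπ, hρ⟩ := h.exists_presentation M
  have := h.noeth_left
  have := h.noeth_right
  have := h.finite_left
  have := h.finite_right
  have := h.free_right
  have := h.finite_doubleDual (M := M)
  let Φ := matrixMap S D ρ
  have hex : Function.Exact (dualCoord S D π) Φ.rangeRestrict := by
    intro c
    rw [← dualCoord_exact π hπ ρ hρ c]
    exact ⟨fun e => congrArg Subtype.val e, fun e => Subtype.ext e⟩
  let c₁ := extModConnecting R D (dualCoord_injective (S := S) (D := D) π hπ) hex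
    Φ.surjective_rangeRestrict 0 ∘ₗ homToExtMod R S D (M →ₗ[R] D)
  let c₂ := extModConnecting R D (LinearMap.range Φ).injective_subtype
    (LinearMap.exact_subtype_mkQ _) (Submodule.mkQ_surjective _) 1
  let c : DoubleDual R S D M →ₗ[R] ExtMod S D ((Fin m → D) ⧸ LinearMap.range Φ) 2 := c₂ ∘ₗ c₁
  refine (h.exact.le_of_ker_le (LinearMap.range (eval R S D M)).mkQ (Submodule.mkQ_surjective _)
    c fun F hF => ?_).trans (h.dim_range_ext_le c)
  have hF₁ : c₁ F = 0 := by
    refine extModConnecting_one_injective (R := R) (LinearMap.range Φ).injective_subtype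
      (LinearMap.exact_subtype_mkQ _) (Submodule.mkQ_surjective _) ?_
    rw [map_zero]
    exact hF
  obtain ⟨f, hf⟩ := exists_extension_of_connecting_eq_zero (R := R)
    (dualCoord_injective (S := S) (D := D) π hπ) hex Φ.surjective_rangeRestrict F.toHom hF₁
  obtain ⟨r, hr⟩ := h.exists_coeff f
  rw [Submodule.ker_mkQ]
  refine ⟨π r, DoubleDual.ext fun φ => ?_⟩
  rw [← hf, eval_toHom, finrepr_map]
  exact (hr _).symm

/-- If `π r` is killed by every functional, then `r`, read as a functional on `D^n`, vanishes on
`M*` and factors through the image `I` of `Φ`. The factorization extends to `D^m` only if `r` is a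
combination of relations, that is, `π r = 0`. So the kernel is detected in `Ext¹(D^m/I, D)`. -/
theorem dim_ker_eval_le [Module.Finite R M] :
    δ R (LinearMap.ker (eval R S D M)) ≤ codim d 1 := by
  obtain ⟨n, m, π, ρ, hπ, hρ⟩ := h.exists_presentation M
  have := h.noeth_left
  have := h.noeth_right
  have := h.finite_left
  have := h.finite_right
  let Φ := matrixMap S D ρ
  let c := extModConnecting R D (LinearMap.range Φ).injective_subtype
    (LinearMap.exact_subtype_mkQ _) (Submodule.mkQ_surjective _) 0 ∘ₗ
      homToExtMod R S D (LinearMap.range Φ)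
  -- Vectors `r` together with a factorization through the range of `Φ`. Both the kernel of
  -- evaluation and the obstruction in `Ext¹` receive maps from `L`, so no map out of the kernel has
  -- to be constructed.
  let L : Submodule R ((Fin n → R) × (LinearMap.range Φ →ₗ[S] D)) :=
    { carrier := {p | ∀ x, p.2 (Φ.rangeRestrict x) = ∑ j, p.1 j • x j}
      add_mem' := fun {p q} hp hq x => by
        simp only [Prod.fst_add, Prod.snd_add, LinearMap.add_apply, Pi.add_apply, add_smul,
          Finset.sum_add_distrib, hp x, hq x]
      zero_mem' := fun x => by simp
      smul_mem' := fun r p hp x => by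
        simp only [Prod.smul_fst, Prod.smul_snd, LinearMap.smul_apply, Pi.smul_apply, hp x,
          Finset.smul_sum, smul_smul, smul_eq_mul] }
  let q : L →ₗ[R] ExtMod S D ((Fin m → D) ⧸ LinearMap.range Φ) 1 :=
    c ∘ₗ LinearMap.snd R _ _ ∘ₗ L.subtype
  have hmem : ∀ p : L, π p.1.1 ∈ LinearMap.ker (eval R S D M) := by
    intro p
    refine DoubleDual.ext fun φ => ?_
    rw [eval_toHom, finrepr_map]
    refine (p.2 (dualCoord S D π φ)).symm.trans ?_
    have : Φ.rangeRestrict (dualCoord S D π φ) = 0 :=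
      Subtype.ext ((dualCoord_exact π hπ ρ hρ).apply_apply_eq_zero φ)
    rw [this, map_zero, toHom_zero]
  let p : L →ₗ[R] LinearMap.ker (eval R S D M) :=
    (π ∘ₗ LinearMap.fst R _ _ ∘ₗ L.subtype).codRestrict _ hmem
  have hp : Function.Surjective p := by
    rintro ⟨x, hx⟩
    obtain ⟨r, rfl⟩ := hπ x
    let ψ : (Fin n → D) →ₗ[S] D := ∑ j, DistribSMul.toLinearMap S D (r j) ∘ₗ LinearMap.proj j
    have hψ : ∀ c, ψ c = ∑ j, r j • c j := fun c => by simp [ψ]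
    have hker : LinearMap.ker Φ.rangeRestrict ≤ LinearMap.ker ψ := by
      intro c hc
      obtain ⟨φ, rfl⟩ := (dualCoord_exact π hπ ρ hρ c).1 (congrArg Subtype.val hc)
      rw [LinearMap.mem_ker, hψ]
      exact (finrepr_map π φ r).symm.trans (congrArg (fun F => toHom F φ) hx)
    refine ⟨⟨(r, (LinearMap.ker Φ.rangeRestrict).liftQ ψ hker ∘ₗ
      (Φ.rangeRestrict.quotKerEquivOfSurjective Φ.surjective_rangeRestrict).symm.toLinearMap),
      fun x => ?_⟩, rfl⟩
    have : (Φ.rangeRestrict.quotKerEquivOfSurjective Φ.surjective_rangeRestrict).symm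
        (Φ.rangeRestrict x) = Submodule.Quotient.mk x := by
      rw [LinearEquiv.symm_apply_eq]
      rfl
    change (LinearMap.ker Φ.rangeRestrict).liftQ ψ hker
      ((Φ.rangeRestrict.quotKerEquivOfSurjective Φ.surjective_rangeRestrict).symm
        (Φ.rangeRestrict x)) = _
    rw [this, Submodule.liftQ_apply, hψ]
  -- The factorization is determined by `r`, so `L` embeds in `R^n`.
  have hfin : Module.Finite R L := by
    refine Module.Finite.of_injective (LinearMap.fst R _ _ ∘ₗ L.subtype) ?_
    rintro ⟨⟨r, f⟩, hf⟩ ⟨⟨s, g⟩, hg⟩ hrs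
    obtain rfl : r = s := hrs
    have : f = g := by
      ext y
      obtain ⟨x, rfl⟩ := Φ.surjective_rangeRestrict y
      exact (hf x).trans (hg x).symm
    subst this
    rfl
  refine (h.exact.le_of_ker_le p hp q fun y hy => ?_).trans (h.dim_range_ext_le q)
  obtain ⟨f, hf⟩ := exists_extension_of_connecting_eq_zero (R := R)
    (LinearMap.range Φ).injective_subtype (LinearMap.exact_subtype_mkQ _)
    (Submodule.mkQ_surjective _) y.1.2 hy
  obtain ⟨s, hs⟩ := h.exists_coeff f
  -- An extension to `D^m` has coefficients `s`; comparing coefficients on `D^n` writes the vector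
  -- in terms of the relations.
  have hys : y.1.1 = ∑ i, s i • ρ i := by
    refine h.coeff_ext fun c => ?_
    rw [← y.2 c, ← hf]
    refine (hs _).trans ?_
    simp only [LinearMap.codRestrict_apply, Submodule.subtype_apply, 
      Finset.sum_apply, Pi.smul_apply, smul_eq_mul, Finset.sum_smul, mul_smul]
    rw [Finset.sum_comm]
    refine Finset.sum_congr rfl fun i _ => ?_
    rw [← Finset.smul_sum]
    exact congrArg (s i • ·) (matrixMap_apply ρ c i)
  refine Subtype.ext ?_
  change π y.1.1 = 0
  rw [hys, ← LinearMap.mem_ker, ← hρ]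
  exact Submodule.sum_smul_mem _ _ fun i _ => Submodule.subset_span ⟨i, rfl⟩

end DimFunction.IsDualizing

/-! ### Reflexive hulls of torsion-free modules -/

namespace DimFunction.IsDualizing

open DoubleDual

variable {δ : DimFunction.{u}} {d : ℕ} {R S D : Type u} [Ring R] [Ring S]
    [AddCommGroup D] [Module R D] [Module S D] [SMulCommClass R S D] [SMulCommClass S R D]
    (h : δ.IsDualizing d R S D)
variable {M : Type u} [AddCommGroup M] [Module R M] {L : Type u} [AddCommGroup L] [Module R L]

include h

theorem eval_injective [Module.Finite R M] (hM : TorsionFree δ (codim d 1) R M) :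
    Function.Injective (eval R S D M) :=
  LinearMap.ker_eq_bot.1 (hM _ h.dim_ker_eval_le)

/-- Evaluations at functionals separate points of the double dual, and each vanishes on a submodule
of codimension one. -/
theorem torsionFree_doubleDual [Module.Finite R M] :
    TorsionFree δ (codim d 1) R (DoubleDual R S D M) := by
  intro W hW
  have := h.noeth_left
  have := h.finite_doubleDual (M := M)
  rw [eq_bot_iff]
  intro F hF
  refine DoubleDual.ext fun φ => ?_
  exact LinearMap.congr_fun (h.hom_eq_zero hW (apply φ ∘ₗ W.subtype)) ⟨F, hF⟩

theorem torsionFree_self : TorsionFree δ (codim d 1) R D := by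
  intro W hW
  have := h.noeth_left
  have := h.finite_left
  rw [eq_bot_iff]
  intro x hx
  exact LinearMap.congr_fun (h.hom_eq_zero hW W.subtype) ⟨x, hx⟩

/-- The difference of the two maps factors through the cokernel of `i`, which has no nonzero map to
`D`. -/
theorem comp_injective {i : M →ₗ[R] L} [Module.Finite R L]
    (hi : δ R (L ⧸ LinearMap.range i) ≤ codim d 2) {ψ χ : L →ₗ[R] D} (hψχ : ψ ∘ₗ i = χ ∘ₗ i) :
    ψ = χ := by
  have hle : LinearMap.range i ≤ LinearMap.ker (ψ - χ) := by
    rintro _ ⟨m, rfl⟩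
    rw [LinearMap.mem_ker, LinearMap.sub_apply, sub_eq_zero]
    exact LinearMap.congr_fun hψχ m
  have hz := h.hom_eq_zero (hi.trans (codim_anti d one_le_two)) ((LinearMap.range i).liftQ _ hle)
  ext x
  rw [← sub_eq_zero]
  exact LinearMap.congr_fun hz (Submodule.Quotient.mk x)

/-- A functional on the double dual is determined by its restriction to `M`, because evaluation has
small cokernel. Hence it is evaluation at that restriction, and the triple dual is the dual. -/
theorem isReflexiveModule_doubleDual [Module.Finite R M] :
    IsReflexiveModule R S D (DoubleDual R S D M) := by
  have hfin := h.finite_doubleDual (M := M)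
  have key : ∀ ψ : DoubleDual R S D M →ₗ[R] D, ψ = apply (ψ ∘ₗ eval R S D M) := fun ψ =>
    h.comp_injective h.dim_coker_eval_le rfl
  refine ⟨hfin, fun F G hFG => ?_, fun G => ?_⟩
  · exact DoubleDual.ext fun φ => LinearMap.congr_fun hFG (apply φ)
  · let F : DoubleDual R S D M := G ∘ₗ
      ({ toFun := apply, map_add' := fun φ ψ => ?_, map_smul' := fun s φ => ?_ } :
        (M →ₗ[R] D) →ₗ[S] (DoubleDual R S D M →ₗ[R] D))
    · refine ⟨F, LinearMap.ext fun ψ => ?_⟩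
      rw [key ψ]
      rfl
    · exact LinearMap.ext fun F => map_add F.toHom φ ψ
    · exact LinearMap.ext fun F => map_smul F.toHom s φ

/-- Restriction identifies the duals of `L` and `M`: it is injective and surjective since `Hom` and
`Ext¹` of the cokernel into `D` vanish. A point of `L` thus acts on `M*`, reflexivity gives a point
of `M` acting the same way, and torsion-freeness of `L` makes the two points equal. -/
theorem surjective_of_isReflexiveModule (hM : IsReflexiveModule R S D M) [Module.Finite R L]
    (hL : TorsionFree δ (codim d 1) R L) (i : M →ₗ[R] L) (hi : Function.Injective i)
    (hcoker : δ R (L ⧸ LinearMap.range i) ≤ codim d 2) : Function.Surjective i := by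
  intro l
  let res : (L →ₗ[R] D) →ₗ[S] (M →ₗ[R] D) :=
    { toFun := fun ψ => ψ ∘ₗ i, map_add' := fun _ _ => rfl, map_smul' := fun _ _ => rfl }
  let e := LinearEquiv.ofBijective res ⟨fun ψ χ hψχ => h.comp_injective hcoker hψχ,
    fun φ => h.exists_extension i hi inferInstance hcoker φ⟩
  obtain ⟨m, hm⟩ := hM.2.2 ((eval R S D L l).toHom ∘ₗ e.symm.toLinearMap)
  refine ⟨m, h.eval_injective hL (DoubleDual.ext fun ψ => ?_)⟩
  have := LinearMap.congr_fun hm (e ψ)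
  refine this.trans ?_
  change (eval R S D L l).toHom (e.symm (e ψ)) = _
  rw [LinearEquiv.symm_apply_apply]

/-- Finitely many generators of the dual over `S` already separate the points of `M`. -/
theorem exists_injective_pi [Module.Finite R M] (hM : TorsionFree δ (codim d 1) R M) :
    ∃ (n : ℕ) (f : M →ₗ[R] (Fin n → D)), Function.Injective f := by
  have := h.noeth_right
  have := h.finite_right
  have : Module.Finite S (M →ₗ[R] D) := finite_linearMap
  obtain ⟨n, φ, hφ⟩ := Module.Finite.exists_fin (R := S) (M := M →ₗ[R] D)
  refine ⟨n, LinearMap.pi φ, fun x y hxy => h.eval_injective hM (DoubleDual.ext fun ψ => ?_)⟩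
  have hmem : ψ ∈ Submodule.span S (Set.range φ) := hφ ▸ Submodule.mem_top
  rw [eval_toHom, eval_toHom]
  induction hmem using Submodule.span_induction with
  | mem ψ hψ =>
    obtain ⟨j, rfl⟩ := hψ
    exact congrFun hxy j
  | zero => rfl
  | add ψ χ _ _ hψ hχ => rw [LinearMap.add_apply, LinearMap.add_apply, hψ, hχ]
  | smul s ψ _ hψ => rw [LinearMap.smul_apply, LinearMap.smul_apply, hψ]

/-- Linear maps to powers of `D` extend along injections with cokernel of codimension two, without
finiteness assumptions. -/
theorem exists_extension_pi (i : M →ₗ[R] L) (hi : Function.Injective i)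
    (hcoker : δ R (L ⧸ LinearMap.range i) ≤ codim d 2) {n : ℕ} (f : M →ₗ[R] (Fin n → D)) :
    ∃ g : L →ₗ[R] (Fin n → D), g ∘ₗ i = f := by
  have : Fact (Function.Injective i) := ⟨hi⟩
  -- The vanishing of `Ext¹` is available only for finitely generated modules, so a maximal partial
  -- extension is enlarged by one generator at a time, where the quotient is cyclic.
  let E := Module.Baer.extensionOfMax i f
  have htop : E.domain = ⊤ := by
    refine Submodule.eq_top_iff'.2 fun y => ?_
    let Y : Submodule R L := E.domain ⊔ Submodule.span R {y}
    have hY : E.domain ≤ Y := le_sup_left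
    let j : E.domain →ₗ[R] Y := Submodule.inclusion hY
    have hj : Function.Injective j := Submodule.inclusion_injective hY
    have hjr : LinearMap.range j = E.domain.comap Y.subtype := Submodule.range_inclusion _ _ hY
    have hfin : Module.Finite R (Y ⧸ LinearMap.range j) := by
      have hyY : y ∈ Y := Submodule.mem_sup_right (Submodule.mem_span_singleton_self y)
      refine Module.Finite.of_surjective (LinearMap.toSpanSingleton R (Y ⧸ LinearMap.range j)
        (Submodule.Quotient.mk ⟨y, hyY⟩)) fun x => ?_
      obtain ⟨⟨x, hx⟩, rfl⟩ := Submodule.Quotient.mk_surjective _ x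
      obtain ⟨a, ha, b, hb, rfl⟩ := Submodule.mem_sup.1 hx
      obtain ⟨r, rfl⟩ := Submodule.mem_span_singleton.1 hb
      refine ⟨r, ?_⟩
      rw [LinearMap.toSpanSingleton_apply, ← Submodule.Quotient.mk_smul,
        Submodule.Quotient.eq, hjr, Submodule.mem_comap]
      simpa using ha
    -- This quotient embeds in `L ⧸ E.domain`, which is itself a quotient of `L ⧸ range i`.
    have hdim : δ R (Y ⧸ LinearMap.range j) ≤ codim d 2 := by
      refine le_trans ?_ hcoker
      refine le_trans ?_ (h.exact.le_of_surjective (Submodule.factor E.le)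
        (Submodule.factor_surjective E.le))
      refine h.exact.le_of_injective (Submodule.mapQ _ _ Y.subtype hjr.le) ?_
      rw [← LinearMap.ker_eq_bot, Submodule.ker_mapQ, ← hjr, Submodule.mkQ_map_self]
    choose g hg using fun k => h.exists_extension j hj hfin hdim
      (LinearMap.proj k ∘ₗ E.toLinearPMap.toFun)
    have hgE : ∀ x : E.domain, LinearMap.pi g (j x) = E.toLinearPMap x := fun x =>
      funext fun k => LinearMap.congr_fun (hg k) x
    let E' : Module.Baer.ExtensionOf i f :=
      { domain := Y
        toFun := LinearMap.pi g
        le := E.le.trans hY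
        is_extension := fun m => (E.is_extension m).trans (hgE _).symm }
    have hle : E ≤ E' := ⟨hY, fun x x' hxx' => by
      obtain rfl : j x = x' := Subtype.ext hxx'
      exact (hgE x).symm⟩
    have hEE' := Module.Baer.extensionOfMax_is_max i f E' hle
    have : y ∈ E'.domain := Submodule.mem_sup_right (Submodule.mem_span_singleton_self y)
    rw [hEE'] at this
    exact this
  refine ⟨E.toLinearPMap.toFun ∘ₗ (LinearEquiv.ofTop _ htop).symm.toLinearMap,
    LinearMap.ext fun m => (E.is_extension m).symm⟩

/-- An embedding of `M` in `D^n` extends to `L`. The kernel of the extension meets `M` in zero, so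
it embeds in the cokernel of `i` and vanishes by torsion-freeness. Thus `L` embeds in `D^n`. -/
theorem finite_of_extension [Module.Finite R M] (i : M →ₗ[R] L) (hi : Function.Injective i)
    (hL : TorsionFree δ (codim d 1) R L)
    (hcoker : δ R (L ⧸ LinearMap.range i) ≤ codim d 2) : Module.Finite R L := by
  have := h.noeth_left
  have := h.finite_left
  obtain ⟨n, f, hf⟩ := h.exists_injective_pi (hL.of_injective h.exact i hi)
  obtain ⟨g, rfl⟩ := h.exists_extension_pi i hi hcoker f
  have hg : LinearMap.ker g = ⊥ := by
    refine hL _ (le_trans ?_ (hcoker.trans (codim_anti d one_le_two)))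
    refine h.exact.le_of_injective ((LinearMap.range i).mkQ ∘ₗ (LinearMap.ker g).subtype) ?_
    rw [← LinearMap.ker_eq_bot, eq_bot_iff]
    rintro ⟨x, hx⟩ hx'
    obtain ⟨m, rfl⟩ : x ∈ LinearMap.range i := (Submodule.Quotient.mk_eq_zero _).1 hx'
    have : m = 0 := hf (by simpa using hx)
    subst this
    exact Subtype.ext (map_zero i)
  exact Module.Finite.of_injective g (LinearMap.ker_eq_bot.1 hg)

end DimFunction.IsDualizing

/-! ### Reflexive hulls of bimodules

A bimodule is treated here as a module over two rings `R` and `Q` with commuting actions. -/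

section Stable

variable {R Q M : Type u} [Ring R] [Ring Q] [AddCommGroup M] [Module R M] [Module Q M]

/-- A `Q`-submodule that is stable under `R`, as an `R`-module. -/
abbrev Submodule.stableModule (W : Submodule Q M) (hW : ∀ (r : R), ∀ m ∈ W, r • m ∈ W) :
    Module R W where
  smul r x := ⟨r • x.1, hW r x.1 x.2⟩
  one_smul x := Subtype.ext (one_smul R x.1)
  mul_smul r s x := Subtype.ext (mul_smul r s x.1)
  smul_zero r := Subtype.ext (smul_zero r)
  smul_add r x y := Subtype.ext (smul_add r x.1 y.1)
  add_smul r s x := Subtype.ext (add_smul r s x.1)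
  zero_smul x := Subtype.ext (zero_smul R x.1)

/-- The quotient by an `R`-stable `Q`-submodule, as an `R`-module. -/
abbrev Submodule.quotientStableModule [SMulCommClass R Q M] (W : Submodule Q M)
    (hW : ∀ (r : R), ∀ m ∈ W, r • m ∈ W) : Module R (M ⧸ W) where
  smul r := W.mapQ W (DistribSMul.toLinearMap Q M r) (hW r)
  one_smul x := by
    obtain ⟨x, rfl⟩ := Submodule.Quotient.mk_surjective _ x
    exact congrArg Submodule.Quotient.mk (one_smul R x)
  mul_smul r s x := by
    obtain ⟨x, rfl⟩ := Submodule.Quotient.mk_surjective _ x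
    exact congrArg Submodule.Quotient.mk (mul_smul r s x)
  smul_zero r := map_zero (W.mapQ W (DistribSMul.toLinearMap Q M r) (hW r))
  smul_add r := map_add (W.mapQ W (DistribSMul.toLinearMap Q M r) (hW r))
  add_smul r s x := by
    obtain ⟨x, rfl⟩ := Submodule.Quotient.mk_surjective _ x
    exact congrArg Submodule.Quotient.mk (add_smul r s x)
  zero_smul x := by
    obtain ⟨x, rfl⟩ := Submodule.Quotient.mk_surjective _ x
    exact congrArg Submodule.Quotient.mk (zero_smul R x)

end Stable

/-! ### Passing torsion and cokernel bounds between the two sides of a bimodule. -/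

namespace DimFunction

/-- The unbundled form of the symmetry condition: `c : k` acts on central bimodules through both
`κR c` and `κQ c`. -/
def IsSymmetricPair (δ : DimFunction.{u}) {k : Type v} {R Q : Type u} [Ring R] [Ring Q]
    (κR : k → R) (κQ : k → Q) : Prop :=
  ∀ (M : Type u) [AddCommGroup M] [Module R M] [Module Q M] [SMulCommClass Q R M],
    (∀ (c : k) (m : M), κR c • m = κQ c • m) →
      (Module.Finite R M → δ Q M ≤ δ R M) ∧ (Module.Finite Q M → δ R M ≤ δ Q M)

theorem IsSymmetricPair.symm {δ : DimFunction.{u}} {k : Type v} {R Q : Type u} [Ring R] [Ring Q]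
    {κR : k → R} {κQ : k → Q} (hs : δ.IsSymmetricPair κR κQ) : δ.IsSymmetricPair κQ κR := by
  intro M _ _ _ _ hM
  have : SMulCommClass Q R M := SMulCommClass.symm _ _ _
  exact (hs M fun c m => (hM c m).symm).symm

section Torsion

variable {δ : DimFunction.{u}} {k : Type v} {R Q : Type u} [Ring R] [Ring Q]
    {κR : k → R} {κQ : k → Q}
variable {M : Type u} [AddCommGroup M] [Module R M] [Module Q M] [SMulCommClass Q R M]
  {e : EReal}

theorem smul_mem_torsion (hQ : δ.IsExact Q) (r : R) (m : M) (hm : m ∈ torsion δ e Q M) :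
    r • m ∈ torsion δ e Q M := by
  have : SMulCommClass R Q M := SMulCommClass.symm _ _ _
  exact hQ.map_mem_torsion (DistribSMul.toLinearMap Q M r) hm

/-- The `Q`-torsion is also an `R`-submodule; once its `R`-dimension is at most `e`, it must vanish.
-/
theorem torsionFree_of_stable (hR : δ.IsExact R) (hQ : δ.IsExact Q) {e' : EReal}
    (hM : TorsionFree δ e R M)
    (hle : letI := (torsion δ e' Q M).stableModule (R := R) (smul_mem_torsion hQ)
      δ R (torsion δ e' Q M) ≤ e) : TorsionFree δ e' Q M := by
  let := (torsion δ e' Q M).stableModule (R := R) (smul_mem_torsion hQ)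
  let f : torsion δ e' Q M →ₗ[R] M :=
    { toFun := Subtype.val, map_add' := fun _ _ => rfl, map_smul' := fun _ _ => rfl }
  have hf := hM (LinearMap.range f) ((hR.range_le f).trans hle)
  refine TorsionFree.eq_bot_of_torsion (eq_bot_iff.2 fun x hx => ?_)
  have : x ∈ LinearMap.range f := ⟨⟨x, hx⟩, rfl⟩
  rw [hf] at this
  exact this

theorem IsSymmetricPair.torsionFree (hs : δ.IsSymmetricPair κR κQ) (hR : δ.IsExact R)
    (hQ : δ.IsExact Q) [IsNoetherianRing Q] [Module.Finite Q M]
    (hk : ∀ (c : k) (m : M), κR c • m = κQ c • m)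
    (hM : TorsionFree δ e R M) : TorsionFree δ e Q M := by
  refine torsionFree_of_stable hR hQ hM ?_
  let := (torsion δ e Q M).stableModule (R := R) (smul_mem_torsion hQ)
  have : SMulCommClass Q R (torsion δ e Q M) :=
    ⟨fun q r x => Subtype.ext (smul_comm q r x.1)⟩
  exact ((hs (torsion δ e Q M) fun c x => Subtype.ext (hk c x.1)).2 inferInstance).trans
    hQ.torsion_le

variable {T : Type u} [AddCommGroup T] [Module R T] [Module Q T]

/-- The two cokernels are one bimodule, finitely generated over `R`, so its `Q`-dimension is at most
its `R`-dimension. -/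
theorem IsSymmetricPair.dim_coker_le (hs : δ.IsSymmetricPair κR κQ) (hQ : δ.IsExact Q)
    [Module.Finite R M] (hk : ∀ (c : k) (m : M), κR c • m = κQ c • m)
    (i : T →ₗ[R] M) (j : T →ₗ[Q] M) (hij : ∀ t, i t = j t)
    (hcoker : δ R (M ⧸ LinearMap.range i) ≤ e) : δ Q (M ⧸ LinearMap.range j) ≤ e := by
  have hst : ∀ (q : Q), ∀ m ∈ LinearMap.range i, q • m ∈ LinearMap.range i := by
    rintro q _ ⟨t, rfl⟩
    exact ⟨q • t, by rw [hij, hij, map_smul]⟩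
  let := (LinearMap.range i).quotientStableModule (R := Q) hst
  have : SMulCommClass Q R (M ⧸ LinearMap.range i) := ⟨fun q r x => by
    obtain ⟨x, rfl⟩ := Submodule.Quotient.mk_surjective _ x
    exact congrArg Submodule.Quotient.mk (smul_comm q r x)⟩
  have hle : δ Q (M ⧸ LinearMap.range i) ≤ e := by
    refine le_trans ((hs (M ⧸ LinearMap.range i) fun c x => ?_).1 inferInstance) hcoker
    obtain ⟨x, rfl⟩ := Submodule.Quotient.mk_surjective _ x
    exact congrArg Submodule.Quotient.mk (hk c x)
  let p : M →ₗ[Q] (M ⧸ LinearMap.range i) :=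
    { toFun := Submodule.Quotient.mk, map_add' := fun _ _ => rfl, map_smul' := fun _ _ => rfl }
  have hp : LinearMap.ker p ≤ LinearMap.range j := by
    intro x hx
    obtain ⟨t, rfl⟩ := (Submodule.Quotient.mk_eq_zero _).1 hx
    exact ⟨t, (hij t).symm⟩
  refine (hQ.le_of_ker_le (LinearMap.range j).mkQ (Submodule.mkQ_surjective _) p ?_).trans
    ((hQ.submodule_le _).trans hle)
  rwa [Submodule.ker_mkQ]

/-- The `Q`-torsion of `M` meets `T` in zero, so it embeds `R`-linearly in the cokernel and is small
over `R`. Finite generation over `Q` is not assumed, so this can precede the proof of it. -/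
theorem torsionFree_of_extension (hR : δ.IsExact R) (hQ : δ.IsExact Q)
    (hM : TorsionFree δ e R M) {e' : EReal} (hT : TorsionFree δ e' Q T)
    (i : T →ₗ[R] M) (j : T →ₗ[Q] M) (hij : ∀ t, i t = j t) (hj : Function.Injective j)
    (hcoker : δ R (M ⧸ LinearMap.range i) ≤ e) : TorsionFree δ e' Q M := by
  refine torsionFree_of_stable hR hQ hM ?_
  let := (torsion δ e' Q M).stableModule (R := R) (smul_mem_torsion hQ)
  let f : torsion δ e' Q M →ₗ[R] M :=
    { toFun := Subtype.val, map_add' := fun _ _ => rfl, map_smul' := fun _ _ => rfl }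
  refine (hR.le_of_injective ((LinearMap.range i).mkQ ∘ₗ f) ?_).trans hcoker
  rw [← LinearMap.ker_eq_bot, eq_bot_iff]
  rintro ⟨x, hx⟩ hx'
  obtain ⟨t, rfl⟩ : x ∈ LinearMap.range i := (Submodule.Quotient.mk_eq_zero _).1 hx'
  have hcomap : (torsion δ e' Q M).comap j = ⊥ := by
    refine hT _ (le_trans ?_ (hQ.torsion_le (M := M) (e := e')))
    refine hQ.le_of_injective ((j ∘ₗ ((torsion δ e' Q M).comap j).subtype).codRestrict _
      fun x => x.2) fun x y hxy => ?_
    exact Subtype.ext (hj (congrArg Subtype.val hxy))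
  have ht : t ∈ (torsion δ e' Q M).comap j := by
    rw [Submodule.mem_comap, ← hij]
    exact hx
  rw [hcomap, Submodule.mem_bot] at ht
  subst ht
  exact Subtype.ext (map_zero i)

end Torsion

end DimFunction

namespace DoubleDual

/-- The natural map to the double dual, as a linear map for a commuting action. -/
def evalAction (R S D M Q : Type u) [Ring R] [Ring S] [AddCommGroup D] [Module R D] [Module S D]
    [SMulCommClass R S D] [SMulCommClass S R D] [AddCommGroup M] [Module R M] [Ring Q] [Module Q M]
    [SMulCommClass Q R M] : M →ₗ[Q] DoubleDual R S D M where
  toFun := eval R S D M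
  map_add' := map_add _
  map_smul' _ _ := rfl

end DoubleDual

/-! ### Finiteness and reflexivity of the double dual on the other side. -/

namespace DimFunction.IsDualizing

open DoubleDual

variable {δ : DimFunction.{u}} {d : ℕ} {k : Type v} {R S D Q S' D' : Type u} [Ring R] [Ring S]
    [AddCommGroup D] [Module R D] [Module S D] [SMulCommClass R S D] [SMulCommClass S R D]
    [Ring Q] [Ring S']
    [AddCommGroup D'] [Module Q D'] [Module S' D'] [SMulCommClass Q S' D'] [SMulCommClass S' Q D']
    {κR : k → R} {κS : k → S} {κQ : k → Q} {κS' : k → S'}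
variable {T : Type u} [AddCommGroup T] [Module R T] [Module Q T] [SMulCommClass Q R T]

theorem central_doubleDual (hD : ∀ c (x : D), κR c • x = κS c • x)
    (hk : ∀ (c : k) (t : T), κR c • t = κQ c • t) (c : k) (F : DoubleDual R S D T) :
    κR c • F = κQ c • F := by
  refine DoubleDual.ext fun φ => ?_
  rw [action_toHom, toHom_smul, hD, ← map_smul]
  refine congrArg F.toHom (LinearMap.ext fun t => ?_)
  rw [LinearMap.smul_apply, ← hD, LinearMap.comp_apply, DistribSMul.toLinearMap_apply, ← hk,
    map_smul]

variable (hR : δ.IsDualizing d R S D) (hQ : δ.IsDualizing d Q S' D')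
  (hs : δ.IsSymmetricPair κR κQ)

include hR hQ hs

theorem doubleDual_otherSide (hD : ∀ c (x : D), κR c • x = κS c • x)
    (hk : ∀ (c : k) (t : T), κR c • t = κQ c • t)
    [Module.Finite R T] [Module.Finite Q T] (hTR : TorsionFree δ (codim d 1) R T)
    (hTQ : TorsionFree δ (codim d 1) Q T) :
    Module.Finite Q (DoubleDual R S D T) ∧
      TorsionFree δ (codim d 1) Q (DoubleDual R S D T) ∧
      δ Q (DoubleDual R S D T ⧸ LinearMap.range (evalAction R S D T Q)) ≤ codim d 2 := by
  have := hR.finite_doubleDual (M := T)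
  have hinj : Function.Injective (evalAction R S D T Q) := hR.eval_injective hTR
  have hcoker : δ Q (DoubleDual R S D T ⧸ LinearMap.range (evalAction R S D T Q)) ≤ codim d 2 :=
    hs.dim_coker_le hQ.exact (central_doubleDual hD hk) (eval R S D T) _ (fun _ => rfl)
      hR.dim_coker_eval_le
  have htf : TorsionFree δ (codim d 1) Q (DoubleDual R S D T) :=
    torsionFree_of_extension hR.exact hQ.exact hR.torsionFree_doubleDual hTQ (eval R S D T) _
      (fun _ => rfl) hinj (hR.dim_coker_eval_le.trans (codim_anti d one_le_two))
  exact ⟨hQ.finite_of_extension _ hinj htf hcoker, htf, hcoker⟩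

/-- The properties of `doubleDual_otherSide` are used twice: for the `R`-double dual of `T`, and for
the `Q`-double dual of that. The second evaluation map, viewed over `R`, extends a reflexive module
by a small cokernel inside a torsion-free module, so it is onto. -/
theorem isReflexiveModule_otherSide (hD : ∀ c (x : D), κR c • x = κS c • x)
    (hD' : ∀ c (x : D'), κQ c • x = κS' c • x)
    (hk : ∀ (c : k) (t : T), κR c • t = κQ c • t)
    [Module.Finite R T] [Module.Finite Q T] (hTR : TorsionFree δ (codim d 1) R T) :
    IsReflexiveModule Q S' D' (DoubleDual R S D T) := by
  have := hQ.noeth_left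
  obtain ⟨hfin, htf, -⟩ := doubleDual_otherSide hR hQ hs hD hk hTR
    (hs.torsionFree hR.exact hQ.exact hk hTR)
  have := hR.finite_doubleDual (M := T)
  have hcomm : SMulCommClass R Q (DoubleDual R S D T) := SMulCommClass.symm _ _ _
  obtain ⟨hfin', htf', hcoker'⟩ := doubleDual_otherSide hQ hR hs.symm hD'
    (fun c F => (central_doubleDual hD hk c F).symm) htf hR.torsionFree_doubleDual
  have hinj : Function.Injective (eval Q S' D' (DoubleDual R S D T)) := hQ.eval_injective htf
  exact ⟨hfin, hinj, hR.surjective_of_isReflexiveModule hR.isReflexiveModule_doubleDual htf'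
    (evalAction Q S' D' (DoubleDual R S D T) R) hinj hcoker'⟩

end DimFunction.IsDualizing

/-! ### Tensor products over noncommutative rings -/

namespace NCTensor

attribute [local instance] NCTensor.leftAction NCTensor.rightAction

section Lift

variable {R M N : Type u} [Ring R] [AddCommGroup M] [Module Rᵐᵒᵖ M] [AddCommGroup N] [Module R N]

theorem induction_on {p : NCTensor R M N → Prop} (x : NCTensor R M N)
    (tmul : ∀ m n, p (tmul R m n)) (add : ∀ x y, p x → p y → p (x + y)) : p x := by
  obtain ⟨x, rfl⟩ := QuotientAddGroup.mk'_surjective _ x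
  induction x using TensorProduct.induction_on with
  | zero =>
    have := tmul 0 0
    rwa [NCTensor.tmul, TensorProduct.zero_tmul, map_zero] at this
  | tmul m n => exact tmul m n
  | add x y hx hy =>
    rw [map_add]
    exact add _ _ hx hy

/-- The map induced by a balanced biadditive map. -/
noncomputable def lift {G : Type*} [AddCommGroup G] (f : M →+ N →+ G)
    (hf : ∀ (m : M) (r : R) (n : N), f (MulOpposite.op r • m) n = f m (r • n)) :
    NCTensor R M N →+ G :=
  QuotientAddGroup.lift (NCTensor.relations R M N)
    (TensorProduct.liftAddHom f fun c m n => by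
      rw [map_zsmul, map_zsmul, AddMonoidHom.zsmul_apply]) (by
    rw [NCTensor.relations, AddSubgroup.closure_le]
    rintro _ ⟨m, r, n, rfl⟩
    rw [SetLike.mem_coe, AddMonoidHom.mem_ker, map_sub, sub_eq_zero]
    exact hf m r n)

/-- Pure tensors as a biadditive map. -/
def tmulHom (R M N : Type u) [Ring R] [AddCommGroup M] [Module Rᵐᵒᵖ M] [AddCommGroup N]
    [Module R N] : M →+ N →+ NCTensor R M N where
  toFun m := { toFun := tmul R m, map_zero' := by
                rw [tmul, TensorProduct.tmul_zero, map_zero], map_add' := tmul_add m }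
  map_zero' := by
    ext n
    change tmul R 0 n = 0
    rw [tmul, TensorProduct.zero_tmul, map_zero]
  map_add' m m' := AddMonoidHom.ext fun n => add_tmul m m' n

@[simp]
theorem tmulHom_apply (m : M) (n : N) : tmulHom R M N m n = tmul R m n := rfl

@[simp]
theorem tmul_zero (m : M) : tmul R m (0 : N) = 0 := map_zero (tmulHom R M N m)

@[simp]
theorem zero_tmul (n : N) : tmul R (0 : M) n = 0 :=
  DFunLike.congr_fun (map_zero (tmulHom R M N)) n

theorem sub_tmul (m m' : M) (n : N) : tmul R (m - m') n = tmul R m n - tmul R m' n :=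
  DFunLike.congr_fun (map_sub (tmulHom R M N) m m') n

theorem tmul_sub (m : M) (n n' : N) : tmul R m (n - n') = tmul R m n - tmul R m n' :=
  map_sub (tmulHom R M N m) n n'

end Lift

section RightExact

variable {R K M N P : Type u} [Ring R]

/-- Right exactness, by an inverse map from the tensor product with `P` to the quotient by the image
`I`. -/
theorem exact_map_left [AddCommGroup K] [Module Rᵐᵒᵖ K] [AddCommGroup M] [Module Rᵐᵒᵖ M]
    [AddCommGroup P] [Module Rᵐᵒᵖ P] [AddCommGroup N] [Module R N]
    {i : K →ₗ[Rᵐᵒᵖ] M} {f : M →ₗ[Rᵐᵒᵖ] P} (hif : Function.Exact i f)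
    (hf : Function.Surjective f) :
    Function.Exact (map i (LinearMap.id : N →ₗ[R] N)) (map f (LinearMap.id : N →ₗ[R] N)) := by
  let I := (map i (LinearMap.id : N →ₗ[R] N)).range
  have hker : ∀ (m : M) (n : N), f m = 0 → tmul R m n ∈ I := fun m n hm => by
    obtain ⟨x, rfl⟩ := (hif m).1 hm
    exact ⟨tmul R x n, rfl⟩
  have hmk : ∀ (m m' : M) (n : N), f m = f m' →
      QuotientAddGroup.mk' I (tmul R m n) = QuotientAddGroup.mk' I (tmul R m' n) := by
    intro m m' n hm
    rw [← sub_eq_zero, ← map_sub, ← sub_tmul]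
    exact (QuotientAddGroup.eq_zero_iff _).2 (hker _ _ (by rw [map_sub, hm, sub_self]))
  -- A set-theoretic section suffices: by `hmk` its failure to be additive or linear disappears
  -- modulo `I`.
  let σ := Function.surjInv hf
  have hσ : ∀ p, f (σ p) = p := Function.surjInv_eq hf
  let φ : P →+ N →+ (NCTensor R M N ⧸ I) :=
    { toFun := fun p => (QuotientAddGroup.mk' I).comp (tmulHom R M N (σ p))
      map_zero' := AddMonoidHom.ext fun n => (hmk _ 0 n (by rw [hσ, map_zero])).trans (by simp)
      map_add' := fun p p' => AddMonoidHom.ext fun n =>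
        (hmk _ (σ p + σ p') n (by rw [map_add, hσ, hσ, hσ])).trans (by
          rw [add_tmul, map_add]; rfl) }
  let ψ := lift φ fun p r n => by
    refine (hmk _ (MulOpposite.op r • σ p) n (by rw [map_smul, hσ, hσ])).trans ?_
    rw [smul_tmul]
    rfl
  have hψ : ψ.comp (map f LinearMap.id) = QuotientAddGroup.mk' I :=
    addHom_ext fun m n => hmk _ m n (hσ (f m))
  intro t
  constructor
  · intro ht
    have := DFunLike.congr_fun hψ t
    rw [AddMonoidHom.comp_apply, ht, map_zero] at this
    exact (QuotientAddGroup.eq_zero_iff _).1 this.symm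
  · rintro ⟨s, rfl⟩
    rw [← AddMonoidHom.comp_apply, ← map_comp, hif.linearMap_comp_eq_zero, map_zero_left]
    rfl

theorem exact_map_right [AddCommGroup K] [Module R K] [AddCommGroup N] [Module R N]
    [AddCommGroup P] [Module R P] [AddCommGroup M] [Module Rᵐᵒᵖ M]
    {i : K →ₗ[R] N} {f : N →ₗ[R] P} (hif : Function.Exact i f)
    (hf : Function.Surjective f) :
    Function.Exact (map (LinearMap.id : M →ₗ[Rᵐᵒᵖ] M) i) (map (LinearMap.id : M →ₗ[Rᵐᵒᵖ] M) f) := by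
  let I := (map (LinearMap.id : M →ₗ[Rᵐᵒᵖ] M) i).range
  have hker : ∀ (m : M) (n : N), f n = 0 → tmul R m n ∈ I := fun m n hn => by
    obtain ⟨x, rfl⟩ := (hif n).1 hn
    exact ⟨tmul R m x, rfl⟩
  have hmk : ∀ (m : M) (n n' : N), f n = f n' →
      QuotientAddGroup.mk' I (tmul R m n) = QuotientAddGroup.mk' I (tmul R m n') := by
    intro m n n' hn
    rw [← sub_eq_zero, ← map_sub, ← tmul_sub]
    exact (QuotientAddGroup.eq_zero_iff _).2 (hker _ _ (by rw [map_sub, hn, sub_self]))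
  let σ := Function.surjInv hf
  have hσ : ∀ p, f (σ p) = p := Function.surjInv_eq hf
  let φ : M →+ P →+ (NCTensor R M N ⧸ I) :=
    { toFun := fun m =>
        { toFun := fun p => QuotientAddGroup.mk' I (tmul R m (σ p))
          map_zero' := (hmk m _ 0 (by rw [hσ, map_zero])).trans (by simp)
          map_add' := fun p p' => (hmk m _ (σ p + σ p') (by rw [map_add, hσ, hσ, hσ])).trans (by
            rw [tmul_add, map_add]) }
      map_zero' := AddMonoidHom.ext fun p => by simp
      map_add' := fun m m' => AddMonoidHom.ext fun p => by simp [add_tmul] }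
  let ψ := lift φ fun m r p => by
    refine Eq.trans ?_ (hmk m _ (r • σ p) (by rw [map_smul, hσ, hσ])).symm
    rw [← smul_tmul]
    rfl
  have hψ : ψ.comp (map LinearMap.id f) = QuotientAddGroup.mk' I :=
    addHom_ext fun m n => hmk m _ n (hσ (f n))
  intro t
  constructor
  · intro ht
    have := DFunLike.congr_fun hψ t
    rw [AddMonoidHom.comp_apply, ht, map_zero] at this
    exact (QuotientAddGroup.eq_zero_iff _).1 this.symm
  · rintro ⟨s, rfl⟩
    rw [← AddMonoidHom.comp_apply, ← map_comp, hif.linearMap_comp_eq_zero, map_zero_right]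
    rfl

theorem map_surjective {M' N' : Type u} [AddCommGroup M] [Module Rᵐᵒᵖ M] [AddCommGroup M']
    [Module Rᵐᵒᵖ M'] [AddCommGroup N] [Module R N] [AddCommGroup N'] [Module R N']
    {f : M →ₗ[Rᵐᵒᵖ] M'} {g : N →ₗ[R] N'} (hf : Function.Surjective f)
    (hg : Function.Surjective g) : Function.Surjective (map f g) := by
  intro x
  induction x using induction_on with
  | tmul m n =>
    obtain ⟨m, rfl⟩ := hf m
    obtain ⟨n, rfl⟩ := hg n
    exact ⟨tmul R m n, rfl⟩
  | add x y hx hy =>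
    obtain ⟨x, rfl⟩ := hx
    obtain ⟨y, rfl⟩ := hy
    exact ⟨x + y, map_add _ _ _⟩

end RightExact

section Linear

variable {R Q : Type u} [Ring R] [Ring Q] {M M' N N' : Type u} [AddCommGroup M] [Module Rᵐᵒᵖ M]
  [AddCommGroup M'] [Module Rᵐᵒᵖ M'] [AddCommGroup N] [Module R N] [Module Q N]
  [SMulCommClass Q R N] [AddCommGroup N'] [Module R N'] [Module Q N'] [SMulCommClass Q R N']

theorem smul_tmul_right (q : Q) (m : M) (n : N) : q • tmul R m n = tmul R m (q • n) := rfl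

/-- The tensor product of two maps, linear for an action on the right factors. -/
def mapLinear (f : M →ₗ[Rᵐᵒᵖ] M') (g : N →ₗ[R] N') (hg : ∀ (q : Q) (n : N), g (q • n) = q • g n) :
    NCTensor R M N →ₗ[Q] NCTensor R M' N' where
  toFun := map f g
  map_add' := map_add (map f g)
  map_smul' q x := by
    induction x using induction_on with
    | tmul m n => exact congrArg (tmul R (f m)) (hg q n)
    | add x y hx hy => rw [smul_add, map_add, hx, hy, map_add, smul_add]

variable (Q N) in
/-- The functoriality of the tensor product in the left factor. -/
def rMap (f : M →ₗ[Rᵐᵒᵖ] M') : NCTensor R M N →ₗ[Q] NCTensor R M' N :=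
  mapLinear f LinearMap.id fun _ _ => rfl

variable (M) in
/-- The functoriality of the tensor product in the right factor. -/
def lMap (g : N →ₗ[R] N') (hg : ∀ (q : Q) (n : N), g (q • n) = q • g n) :
    NCTensor R M N →ₗ[Q] NCTensor R M N' :=
  mapLinear LinearMap.id g hg

theorem linearMap_ext {G : Type*} [AddCommGroup G] [Module Q G] {φ ψ : NCTensor R M N →ₗ[Q] G}
    (h : ∀ m n, φ (tmul R m n) = ψ (tmul R m n)) : φ = ψ :=
  LinearMap.toAddMonoidHom_injective (addHom_ext h)

variable (Q N) in
/-- Linear combinations of a family in the left factor. -/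
def sumTmul {n : ℕ} (x : Fin n → M) : (Fin n → N) →ₗ[Q] NCTensor R M N where
  toFun a := ∑ i, tmul R (x i) (a i)
  map_add' a b := by simp [tmul_add, Finset.sum_add_distrib]
  map_smul' q a := by simp [Finset.smul_sum, smul_tmul_right]

theorem sumTmul_surjective {n : ℕ} {x : Fin n → M}
    (hx : Submodule.span Rᵐᵒᵖ (Set.range x) = ⊤) :
    Function.Surjective (sumTmul (R := R) Q N x) := by
  intro t
  induction t using induction_on with
  | tmul m a =>
    obtain ⟨c, rfl⟩ := (Submodule.mem_span_range_iff_exists_fun Rᵐᵒᵖ).1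
      (hx ▸ Submodule.mem_top : m ∈ Submodule.span Rᵐᵒᵖ (Set.range x))
    refine ⟨fun i => (c i).unop • a, ?_⟩
    change ∑ i, tmul R (x i) ((c i).unop • a) = _
    have := DFunLike.congr_fun (map_sum (tmulHom R M N) (fun i => c i • x i) Finset.univ) a
    rw [tmulHom_apply, AddMonoidHom.finsetSum_apply] at this
    rw [this]
    exact Finset.sum_congr rfl fun i _ => (smul_tmul (c i).unop (x i) a).symm
  | add s t hs ht =>
    obtain ⟨a, rfl⟩ := hs
    obtain ⟨b, rfl⟩ := ht
    exact ⟨a + b, map_add _ _ _⟩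

theorem finite_right [Module.Finite Rᵐᵒᵖ M] [Module.Finite Q N] :
    Module.Finite Q (NCTensor R M N) := by
  obtain ⟨n, x, hx⟩ := Module.Finite.exists_fin (R := Rᵐᵒᵖ) (M := M)
  exact Module.Finite.of_surjective _ (sumTmul_surjective (Q := Q) (N := N) hx)

theorem dim_le_right {δ : DimFunction.{u}} (h : δ.IsExact Q) {e : EReal} [Module.Finite Rᵐᵒᵖ M]
    (hN : δ Q N ≤ e) : δ Q (NCTensor R M N) ≤ e := by
  obtain ⟨n, x, hx⟩ := Module.Finite.exists_fin (R := Rᵐᵒᵖ) (M := M)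
  exact (h.le_of_surjective _ (sumTmul_surjective (Q := Q) (N := N) hx)).trans (h.pi_le hN n)

end Linear

end NCTensor

/-! ### Tensoring a map of right factors with a finitely presented left factor; associativity and
unit. -/

namespace NCTensor

attribute [local instance] NCTensor.leftAction NCTensor.rightAction

section Presentation

variable {R Q : Type u} [Ring R] [Ring Q] {M N N' : Type u} [AddCommGroup M] [Module Rᵐᵒᵖ M]
  [AddCommGroup N] [Module R N] [Module Q N] [SMulCommClass Q R N]
  [AddCommGroup N'] [Module R N'] [Module Q N'] [SMulCommClass Q R N']

variable (Q N) in
/-- The matrix of relations of a presentation of the left factor. -/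
def relMap {n s : ℕ} (ρ : Fin s → Fin n → Rᵐᵒᵖ) : (Fin s → N) →ₗ[Q] (Fin n → N) where
  toFun b i := ∑ j, (ρ j i).unop • b j
  map_add' a b := by
    ext i
    simp [Finset.sum_add_distrib]
  map_smul' q a := by
    ext i
    simp [Finset.smul_sum, smul_comm q]

theorem relMap_apply {n s : ℕ} (ρ : Fin s → Fin n → Rᵐᵒᵖ) (b : Fin s → N) (i : Fin n) :
    relMap Q N ρ b i = ∑ j, (ρ j i).unop • b j := rfl

theorem sumTmul_apply {n : ℕ} (x : Fin n → M) (a : Fin n → N) :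
    sumTmul (R := R) Q N x a = ∑ i, tmul R (x i) (a i) := rfl

/-- Presents `M ⊗ N` as the cokernel of the relation matrix on powers of `N`, compatibly with the
`Q`-action. -/
theorem exact_relMap_sumTmul {n s : ℕ} (π : (Fin n → Rᵐᵒᵖ) →ₗ[Rᵐᵒᵖ] M)
    (hπ : Function.Surjective π) (ρ : Fin s → Fin n → Rᵐᵒᵖ)
    (hρ : Submodule.span Rᵐᵒᵖ (Set.range ρ) = LinearMap.ker π) :
    Function.Exact (relMap Q N ρ) (sumTmul (R := R) Q N fun i => π (Pi.single i 1)) := by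
  let I := (LinearMap.range (relMap Q N ρ)).toAddSubgroup
  let col : (Fin n → Rᵐᵒᵖ) →+ N →+ (Fin n → N) :=
    { toFun := fun c =>
        { toFun := fun a i => (c i).unop • a
          map_zero' := by ext i; simp
          map_add' := fun a b => by ext i; simp }
      map_zero' := by ext a i; simp
      map_add' := fun c c' => by ext a i; simp [add_smul] }
  have hker : ∀ c ∈ LinearMap.ker π, ∀ a : N, col c a ∈ I := by
    intro c hc a
    rw [← hρ, Submodule.mem_span_range_iff_exists_fun] at hc
    obtain ⟨t, rfl⟩ := hc
    refine ⟨fun j => (t j).unop • a, ?_⟩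
    ext i
    rw [relMap_apply]
    change _ = ((∑ j, t j • ρ j) i).unop • a
    rw [Finset.sum_apply, Finset.unop_sum, Finset.sum_smul]
    refine Finset.sum_congr rfl fun j _ => ?_
    rw [Pi.smul_apply, smul_eq_mul, MulOpposite.unop_mul, mul_smul]
  have hmk : ∀ c c' (a : N), π c = π c' →
      QuotientAddGroup.mk' I (col c a) = QuotientAddGroup.mk' I (col c' a) := by
    intro c c' a hc
    rw [← sub_eq_zero, ← map_sub, ← AddMonoidHom.sub_apply, ← map_sub]
    exact (QuotientAddGroup.eq_zero_iff _).2 (hker _ (by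
      rw [LinearMap.mem_ker, map_sub, hc, sub_self]) a)
  let σ := Function.surjInv hπ
  have hσ : ∀ m, π (σ m) = m := Function.surjInv_eq hπ
  let φ : M →+ N →+ ((Fin n → N) ⧸ I) :=
    { toFun := fun m => (QuotientAddGroup.mk' I).comp (col (σ m))
      map_zero' := AddMonoidHom.ext fun a => (hmk _ 0 a (by rw [hσ, map_zero])).trans (by simp)
      map_add' := fun m m' => AddMonoidHom.ext fun a =>
        (hmk _ (σ m + σ m') a (by rw [map_add, hσ, hσ, hσ])).trans (by
          rw [map_add, AddMonoidHom.add_apply, map_add]; rfl) }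
  let ψ := lift φ fun m r a => by
    refine (hmk _ (MulOpposite.op r • σ m) a (by rw [map_smul, hσ, hσ])).trans ?_
    refine congrArg (QuotientAddGroup.mk' I) (funext fun i => ?_)
    change (MulOpposite.op r • σ m i).unop • a = (σ m i).unop • r • a
    rw [smul_eq_mul, MulOpposite.unop_mul, MulOpposite.unop_op, mul_smul]
  have hψ : ∀ a, ψ (sumTmul (R := R) Q N (fun i => π (Pi.single i 1)) a) =
      QuotientAddGroup.mk' I a := by
    intro a
    rw [sumTmul_apply, map_sum]
    have h1 : ∀ i, ψ (tmul R (π (Pi.single i 1)) (a i)) =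
        QuotientAddGroup.mk' I (Pi.single i (a i)) := by
      intro i
      refine (hmk _ (Pi.single i 1) (a i) (hσ _)).trans ?_
      refine congrArg (QuotientAddGroup.mk' I) (funext fun j => ?_)
      change (Pi.single (M := fun _ => Rᵐᵒᵖ) i 1 j).unop • a i = _
      by_cases hij : j = i
      · subst hij
        simp
      · simp [hij]
    rw [Finset.sum_congr rfl fun i _ => h1 i, ← map_sum, Finset.univ_sum_single]
  intro a
  constructor
  · intro ha
    have := hψ a
    rw [ha, map_zero] at this
    exact (QuotientAddGroup.eq_zero_iff _).1 this.symm
  · rintro ⟨b, rfl⟩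
    rw [sumTmul_apply]
    have h1 : ∀ i, tmul R (π (Pi.single i 1)) (relMap Q N ρ b i) =
        ∑ j, tmul R (π (ρ j i • Pi.single i 1)) (b j) := by
      intro i
      rw [relMap_apply, ← tmulHom_apply, map_sum]
      refine Finset.sum_congr rfl fun j _ => ?_
      rw [tmulHom_apply, map_smul]
      exact (smul_tmul (ρ j i).unop _ _).symm
    rw [Finset.sum_congr rfl fun i _ => h1 i, Finset.sum_comm]
    refine Finset.sum_eq_zero fun j _ => ?_
    have h2 := DFunLike.congr_fun (map_sum (tmulHom R M N)
      (fun i => π (ρ j i • Pi.single i 1)) Finset.univ) (b j)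
    rw [AddMonoidHom.finsetSum_apply, ← map_sum, ← pi_eq_sum_univ',
      LinearMap.mem_ker.1 (hρ ▸ Submodule.subset_span ⟨j, rfl⟩ : ρ j ∈ LinearMap.ker π),
      map_zero] at h2
    exact h2.symm

/-- A chase in the presentations of `M ⊗ N` and `M ⊗ N'`. The action that measures dimension is on
the right factor, so powers of the kernel and cokernel of `g` control the answer and no hypothesis
on `Tor` is needed. -/
theorem dim_ker_lMap_le {δ : DimFunction.{u}} (h : δ.IsExact Q) {e : EReal}
    [IsNoetherianRing Rᵐᵒᵖ] [Module.Finite Rᵐᵒᵖ M] (f : N →ₗ[R] N') (g : N →ₗ[Q] N')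
    (hfg : ∀ n, f n = g n) (hk : δ Q (LinearMap.ker g) ≤ e)
    (hc : δ Q (N' ⧸ LinearMap.range g) ≤ e) :
    δ Q (LinearMap.ker (lMap (Q := Q) M f fun q n => by rw [hfg, hfg, map_smul])) ≤ e := by
  set F := lMap (Q := Q) M f fun q n => by rw [hfg, hfg, map_smul]
  obtain ⟨n, π, hπ⟩ := Module.Finite.exists_fin' Rᵐᵒᵖ M
  obtain ⟨s, ρ, hρ⟩ := Submodule.fg_iff_exists_fin_generating_family.1
    (IsNoetherian.noetherian (LinearMap.ker π))
  let x : Fin n → M := fun i => π (Pi.single i 1)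
  have hx : Submodule.span Rᵐᵒᵖ (Set.range x) = ⊤ := by
    rw [eq_top_iff]
    rintro m -
    obtain ⟨c, rfl⟩ := hπ m
    rw [pi_eq_sum_univ' c, map_sum]
    refine Submodule.sum_mem _ fun i _ => ?_
    rw [map_smul]
    exact Submodule.smul_mem _ _ (Submodule.subset_span ⟨i, rfl⟩)
  have hex := exact_relMap_sumTmul (Q := Q) (N := N) π hπ ρ hρ
  have hex' := exact_relMap_sumTmul (Q := Q) (N := N') π hπ ρ hρ
  have hF : ∀ a, F (sumTmul Q N x a) = sumTmul Q N' x (g.compLeft (Fin n) a) := by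
    intro a
    rw [sumTmul_apply, map_sum, sumTmul_apply]
    exact Finset.sum_congr rfl fun i _ => congrArg (tmul R (x i)) (hfg (a i))
  have hrel : ∀ b, g.compLeft (Fin n) (relMap Q N ρ b) =
      relMap Q N' ρ (g.compLeft (Fin s) b) := by
    intro b
    ext i
    rw [relMap_apply]
    change g (relMap Q N ρ b i) = _
    rw [relMap_apply, map_sum]
    refine Finset.sum_congr rfl fun j _ => ?_
    rw [← hfg, map_smul, hfg]
    rfl
  -- A pair consists of a representative `a` of a kernel element and a witness `b` that `g a` is a
  -- relation.
  let W : Submodule Q ((Fin n → N) × (Fin s → N')) :=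
    LinearMap.eqLocus (g.compLeft (Fin n) ∘ₗ LinearMap.fst Q _ _)
      (relMap Q N' ρ ∘ₗ LinearMap.snd Q _ _)
  let p : W →ₗ[Q] LinearMap.ker F :=
    (sumTmul Q N x ∘ₗ LinearMap.fst Q _ _ ∘ₗ W.subtype).codRestrict _ fun w => by
      change F (sumTmul Q N x w.1.1) = 0
      rw [hF, show g.compLeft (Fin n) w.1.1 = relMap Q N' ρ w.1.2 from w.2]
      exact hex'.apply_apply_eq_zero _
  have hp : Function.Surjective p := by
    rintro ⟨t, ht⟩
    obtain ⟨a, rfl⟩ := sumTmul_surjective (Q := Q) (N := N) hx t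
    rw [LinearMap.mem_ker, hF] at ht
    obtain ⟨b, hb⟩ := (hex' _).1 ht
    exact ⟨⟨(a, b), hb.symm⟩, rfl⟩
  let c : W →ₗ[Q] (Fin s → N' ⧸ LinearMap.range g) :=
    (LinearMap.range g).mkQ.compLeft (Fin s) ∘ₗ LinearMap.snd Q _ _ ∘ₗ W.subtype
  -- Here the witness lifts to `N`: subtracting the lifted relation moves the representative into a
  -- power of `ker g`. The quotient by `K₀` is governed by the cokernel of `g`.
  let K₀ : Submodule Q (LinearMap.ker F) := (LinearMap.ker c).map p
  let r : (Fin n → LinearMap.ker g) →ₗ[Q] LinearMap.ker F :=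
    (sumTmul Q N x ∘ₗ (LinearMap.ker g).subtype.compLeft (Fin n)).codRestrict _ fun a => by
      change F (sumTmul Q N x _) = 0
      rw [hF, show g.compLeft (Fin n) ((LinearMap.ker g).subtype.compLeft (Fin n) a) = 0 from
        funext fun i => (a i).2, map_zero]
  rw [h.eq_max _ K₀]
  refine max_le ?_ ?_
  · refine (h.submodule_mono (L := LinearMap.range r) ?_).trans
      ((h.range_le r).trans (h.pi_le hk n))
    rintro _ ⟨⟨⟨a, b⟩, hab⟩, hb, rfl⟩
    have hb' : ∀ j, ∃ y, g y = b j := fun j =>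
      (Submodule.Quotient.mk_eq_zero (LinearMap.range g)).1 (congrFun hb j)
    choose y hy using hb'
    obtain rfl : g.compLeft (Fin s) y = b := funext hy
    have hab' : g.compLeft (Fin n) a = g.compLeft (Fin n) (relMap Q N ρ y) :=
      Eq.trans hab (hrel y).symm
    refine ⟨fun i => ⟨a i - relMap Q N ρ y i, ?_⟩, Subtype.ext ?_⟩
    · rw [LinearMap.mem_ker, map_sub, sub_eq_zero]
      exact congrFun hab' i
    · change sumTmul Q N x (a - relMap Q N ρ y) = sumTmul Q N x a
      rw [map_sub, hex.apply_apply_eq_zero, sub_zero]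
  · refine (h.le_of_ker_le (K₀.mkQ ∘ₗ p) (K₀.mkQ_surjective.comp hp) c fun w hw => ?_).trans
      ((h.submodule_le _).trans (h.pi_le hc s))
    exact (Submodule.Quotient.mk_eq_zero _).2 ⟨w, hw, rfl⟩

theorem dim_coker_lMap_le_of_exact {δ : DimFunction.{u}} (h : δ.IsExact Q) {e : EReal}
    [Module.Finite Rᵐᵒᵖ M] {C : Type u} [AddCommGroup C] [Module R C] [Module Q C]
    [SMulCommClass Q R C] {f : N →ₗ[R] N'} (hf : ∀ (q : Q) (n : N), f (q • n) = q • f n)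
    {p : N' →ₗ[R] C} (hp : ∀ (q : Q) (n : N'), p (q • n) = q • p n) (hfp : Function.Exact f p)
    (hps : Function.Surjective p) (hC : δ Q C ≤ e) :
    δ Q (NCTensor R M N' ⧸ LinearMap.range (lMap (Q := Q) M f hf)) ≤ e := by
  refine (h.le_of_ker_le (Submodule.mkQ _) (Submodule.mkQ_surjective _)
    (lMap (Q := Q) M p hp) ?_).trans ((h.submodule_le _).trans (dim_le_right h hC))
  rw [Submodule.ker_mkQ]
  exact fun t ht => (exact_map_right (M := M) hfp hps t).1 ht

theorem dim_coker_lMap_le {δ : DimFunction.{u}} (h : δ.IsExact Q) {e : EReal}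
    [Module.Finite Rᵐᵒᵖ M] (f : N →ₗ[R] N') (g : N →ₗ[Q] N')
    (hfg : ∀ n, f n = g n) (hc : δ Q (N' ⧸ LinearMap.range g) ≤ e) :
    δ Q (NCTensor R M N' ⧸
      LinearMap.range (lMap (Q := Q) M f fun q n => by rw [hfg, hfg, map_smul])) ≤ e := by
  have : SMulCommClass R Q N' := SMulCommClass.symm _ _ _
  have hst : ∀ (r : R), ∀ m ∈ LinearMap.range g, r • m ∈ LinearMap.range g := by
    rintro r _ ⟨a, rfl⟩
    exact ⟨r • a, by rw [← hfg, ← hfg, map_smul]⟩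
  let := (LinearMap.range g).quotientStableModule (R := R) hst
  have : SMulCommClass Q R (N' ⧸ LinearMap.range g) := ⟨fun q r x => by
    obtain ⟨x, rfl⟩ := Submodule.Quotient.mk_surjective _ x
    exact congrArg Submodule.Quotient.mk (smul_comm q r x)⟩
  let p : N' →ₗ[R] (N' ⧸ LinearMap.range g) :=
    { toFun := Submodule.Quotient.mk, map_add' := fun _ _ => rfl, map_smul' := fun _ _ => rfl }
  have hfp : Function.Exact f p := fun a =>
    (Submodule.Quotient.mk_eq_zero _).trans
      ⟨fun ⟨y, hy⟩ => ⟨y, (hfg y).trans hy⟩, fun ⟨y, hy⟩ => ⟨y, (hfg y).symm.trans hy⟩⟩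
  have hps : Function.Surjective p := fun x => by
    obtain ⟨x, rfl⟩ := Submodule.Quotient.mk_surjective _ x
    exact ⟨x, rfl⟩
  exact dim_coker_lMap_le_of_exact h _ (p := p) (fun _ _ => rfl) hfp hps hc

end Presentation

section Assoc

variable {R S Q X N P : Type u} [Ring R] [Ring S] [Ring Q] [AddCommGroup X] [Module Rᵐᵒᵖ X]
  [AddCommGroup N] [Module R N] [Module Sᵐᵒᵖ N] [SMulCommClass R Sᵐᵒᵖ N] [SMulCommClass Sᵐᵒᵖ R N]
  [AddCommGroup P] [Module S P] [Module Q P] [SMulCommClass Q S P]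

instance : SMulCommClass Q R (NCTensor S N P) where
  smul_comm q r x := by
    induction x using induction_on with
    | tmul n p => rfl
    | add x y hx hy => simp only [smul_add, hx, hy]

variable (R S X N P) in
/-- The map `x ⊗ n ↦ (p ↦ x ⊗ (n ⊗ p))`. -/
noncomputable def assocAux : NCTensor R X N →+ P →+ NCTensor R X (NCTensor S N P) :=
  lift
    { toFun := fun x => (AddMonoidHom.compHom (tmulHom R X (NCTensor S N P) x)).comp
        (tmulHom S N P)
      map_zero' := by
        ext n p
        exact zero_tmul (tmul S n p)
      map_add' := fun x x' => by
        ext n p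
        exact add_tmul x x' (tmul S n p) }
    fun x r n => AddMonoidHom.ext fun p => smul_tmul r x (tmul S n p)

theorem assocAux_tmul (x : X) (n : N) (p : P) :
    assocAux R S X N P (tmul R x n) p = tmul R x (tmul S n p) := rfl

variable (R S X N P) in
/-- The associativity map of the tensor product, as an additive map. -/
noncomputable def assocHom :
    NCTensor S (NCTensor R X N) P →+ NCTensor R X (NCTensor S N P) :=
  lift (assocAux R S X N P) fun t s p => by
    induction t using induction_on with
    | tmul x n =>
      rw [smul_tmul_right, assocAux_tmul, assocAux_tmul, smul_tmul]
    | add t t' ht ht' =>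
      rw [smul_add, map_add, map_add, AddMonoidHom.add_apply, AddMonoidHom.add_apply, ht, ht']

variable (R S X N P) in
/-- The map `n ⊗ p ↦ (x ⊗ n) ⊗ p`. -/
noncomputable def assocInvAux (x : X) : NCTensor S N P →+ NCTensor S (NCTensor R X N) P :=
  lift ((tmulHom S (NCTensor R X N) P).comp (tmulHom R X N x))
    fun n s p => smul_tmul s (tmul R x n) p

theorem assocInvAux_tmul (x : X) (n : N) (p : P) :
    assocInvAux R S X N P x (tmul S n p) = tmul S (tmul R x n) p := rfl

variable (R S X N P) in
/-- The inverse of the associativity map, as an additive map. -/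
noncomputable def assocInvHom :
    NCTensor R X (NCTensor S N P) →+ NCTensor S (NCTensor R X N) P :=
  lift
    { toFun := assocInvAux R S X N P
      map_zero' := addHom_ext fun n p => by
        rw [assocInvAux_tmul, zero_tmul, zero_tmul, AddMonoidHom.zero_apply]
      map_add' := fun x x' => addHom_ext fun n p => by
        rw [AddMonoidHom.add_apply, assocInvAux_tmul, assocInvAux_tmul, assocInvAux_tmul, add_tmul,
          add_tmul] }
    fun x r t => by
      induction t using induction_on with
      | tmul n p => exact congrArg (fun y => tmul S y p) (smul_tmul r x n)
      | add t t' ht ht' => rw [smul_add, map_add, map_add, ht, ht']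

variable (R S Q X N P) in
/-- The associativity of the tensor product. -/
noncomputable def assoc :
    NCTensor S (NCTensor R X N) P ≃ₗ[Q] NCTensor R X (NCTensor S N P) where
  toFun := assocHom R S X N P
  invFun := assocInvHom R S X N P
  map_add' := map_add _
  map_smul' q t := by
    induction t using induction_on with
    | tmul t p =>
      induction t using induction_on with
      | tmul x n => rfl
      | add t t' ht ht' =>
        rw [add_tmul, smul_add, map_add, ht, ht', map_add, smul_add]
    | add t t' ht ht' => rw [smul_add, map_add, ht, ht', map_add, smul_add]
  left_inv t := by
    induction t using induction_on with
    | tmul t p =>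
      induction t using induction_on with
      | tmul x n => rfl
      | add t t' ht ht' => rw [add_tmul, map_add, map_add, ht, ht']
    | add t t' ht ht' => rw [map_add, map_add, ht, ht']
  right_inv t := by
    induction t using induction_on with
    | tmul x t =>
      induction t using induction_on with
      | tmul n p => rfl
      | add t t' ht ht' => rw [tmul_add, map_add, map_add, ht, ht']
    | add t t' ht ht' => rw [map_add, map_add, ht, ht']

theorem assoc_rMap_rMap {X' : Type u} [AddCommGroup X'] [Module Rᵐᵒᵖ X'] (f : X →ₗ[Rᵐᵒᵖ] X')
    (t : NCTensor S (NCTensor R X N) P) :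
    assoc R S Q X' N P (rMap Q P (rMap Sᵐᵒᵖ N f) t) =
      rMap Q (NCTensor S N P) f (assoc R S Q X N P t) := by
  induction t using induction_on with
  | tmul t p =>
    induction t using induction_on with
    | tmul x n => rfl
    | add t t' ht ht' => rw [add_tmul, map_add, map_add, ht, ht', map_add, map_add]
  | add t t' ht ht' => rw [map_add, map_add, ht, ht', map_add, map_add]

end Assoc

section Unit

variable (R X : Type u) [Ring R] [AddCommGroup X] [Module Rᵐᵒᵖ X]

/-- The unit map of the tensor product. -/
noncomputable def unit : X ≃ₗ[Rᵐᵒᵖ] NCTensor R X R where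
  toFun x := tmul R x 1
  invFun := lift
    { toFun := fun x => { toFun := fun r => MulOpposite.op r • x
                          map_zero' := by simp
                          map_add' := fun r s => by simp [add_smul] }
      map_zero' := by ext; simp
      map_add' := fun x y => by ext; simp }
    fun x r s => by
      change MulOpposite.op s • MulOpposite.op r • x = MulOpposite.op (r * s) • x
      rw [smul_smul, MulOpposite.op_mul]
  map_add' x y := add_tmul x y 1
  map_smul' r x := by
    refine (smul_tmul r.unop x 1).trans (congrArg (tmul R x) ?_)
    change r.unop * 1 = 1 * r.unop
    rw [one_mul, mul_one]
  left_inv x := one_smul Rᵐᵒᵖ x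
  right_inv t := by
    induction t using induction_on with
    | tmul x r =>
      refine (smul_tmul r x 1).trans (congrArg (tmul R x) ?_)
      exact mul_one r
    | add t t' ht ht' =>
      refine Eq.trans ?_ (congrArg₂ (· + ·) ht ht')
      rw [map_add]
      exact add_tmul _ _ _

end Unit

end NCTensor

/-! ### The first left derived functor and kernels -/

section Derived

variable {A B : Type u} [Ring A] [Ring B]

/-- The part of the long exact sequence of left derived functors that computes the kernel of
`F X₁ ⟶ F X₂`. -/
theorem exists_leftDerived_one_exact (F : ModuleCat.{u} A ⥤ ModuleCat.{u} B) [F.Additive]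
    [Limits.PreservesFiniteColimits F] {S : ShortComplex (ModuleCat.{u} A)} (hS : S.ShortExact) :
    ∃ τ : (F.leftDerived 1).obj S.X₃ ⟶ F.obj S.X₁,
      LinearMap.ker (F.map S.f).hom ≤ LinearMap.range τ.hom := by
  let P := projectiveResolution S.X₃
  have hmono := hS.mono_f
  have hepi := hS.epi_g
  let π : P.complex.X 0 ⟶ S.X₃ := P.π.f 0
  let d : P.complex.X 1 ⟶ P.complex.X 0 := P.complex.d 1 0
  have hdπ : d ≫ π = 0 := P.complex_d_comp_π_f_zero
  -- Comparison of the resolution of `S.X₃` with the short exact sequence; `a₁` induces `τ` on first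
  -- homology.
  let a₀ : P.complex.X 0 ⟶ S.X₂ := Projective.factorThru π S.g
  have ha₀ : a₀ ≫ S.g = π := Projective.factorThru_comp _ _
  let a₁ : P.complex.X 1 ⟶ S.X₁ := hS.exact.lift (d ≫ a₀) (by rw [Category.assoc, ha₀, hdπ])
  have ha₁ : a₁ ≫ S.f = d ≫ a₀ := hS.exact.lift_f _ _
  have hd₂ : P.complex.d 2 1 ≫ a₁ = 0 := by
    rw [← cancel_mono S.f, Category.assoc, ha₁, ← Category.assoc, P.complex.d_comp_d,
      Limits.zero_comp, Limits.zero_comp]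
  let K := (F.mapHomologicalComplex (ComplexShape.down ℕ)).obj P.complex
  let b₁ : K.X 1 ⟶ F.obj S.X₁ := F.map a₁
  let τ' : K.opcycles 1 ⟶ F.obj S.X₁ := K.descOpcycles b₁ 2 (by simp) (by
    change F.map (P.complex.d 2 1) ≫ F.map a₁ = 0
    rw [← F.map_comp, hd₂, F.map_zero])
  let e : (F.leftDerived 1).obj S.X₃ ≅ K.homology 1 := P.isoLeftDerivedObj F 1
  refine ⟨e.hom ≫ K.homologyι 1 ≫ τ', fun t ht => ?_⟩
  -- The sequence `P₁ → X₁ ⊕ P₀ → X₂ → 0` is exact and remains so under `F`. If `t` dies in `F X₂`,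
  -- then `(t, 0)` lifts to some `z` in `F P₁` with `F a₁ z = t` and `F d z = 0`.
  let E := ModuleCat.of A (S.X₁ × P.complex.X 0)
  let φ : P.complex.X 1 ⟶ E := ModuleCat.ofHom (a₁.hom.prod d.hom)
  let χ : E ⟶ S.X₂ := ModuleCat.ofHom (S.f.hom.coprod (-a₀.hom))
  have hφχ : φ ≫ χ = 0 := by
    ext x
    have := congrArg (fun h => h.hom x) ha₁
    change S.f.hom (a₁.hom x) + -a₀.hom (d.hom x) = 0
    rw [← sub_eq_add_neg, sub_eq_zero]
    exact this
  have hex : (ShortComplex.mk φ χ hφχ).Exact := by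
    rw [ShortComplex.moduleCat_exact_iff]
    rintro ⟨x, p⟩ hxp
    have hxp' : S.f.hom x = a₀.hom p := by
      rw [← sub_eq_zero, sub_eq_add_neg]
      exact hxp
    have hπp : π.hom p = 0 := by
      rw [← ha₀]
      change S.g.hom (a₀.hom p) = 0
      rw [← hxp']
      exact congrArg (fun h => h.hom x) S.zero
    obtain ⟨y, hy⟩ := (ShortComplex.moduleCat_exact_iff _).1 P.exact₀ p hπp
    refine ⟨y, Prod.ext ((ModuleCat.mono_iff_injective S.f).1 hmono ?_) hy⟩
    change S.f.hom (a₁.hom y) = S.f.hom x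
    rw [hxp', ← show d.hom y = p from hy]
    exact congrArg (fun h => h.hom y) ha₁
  have hχ : Epi χ := by
    rw [ModuleCat.epi_iff_surjective]
    intro y
    have hπs : Function.Surjective π := (ModuleCat.epi_iff_surjective π).1
      (inferInstanceAs (Epi (P.π.f 0)))
    obtain ⟨p, hp⟩ := hπs (S.g y)
    have hg : S.g.hom (y - a₀.hom p) = 0 := by
      rw [map_sub, sub_eq_zero, ← show π.hom p = S.g.hom y from hp, ← ha₀]
      rfl
    obtain ⟨x, hx⟩ := (ShortComplex.moduleCat_exact_iff _).1 hS.exact _ hg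
    refine ⟨(x, -p), ?_⟩
    change S.f.hom x + -a₀.hom (-p) = y
    rw [map_neg, neg_neg, show S.f.hom x = y - a₀.hom p from hx, sub_add_cancel]
  have hFex := ((F.preservesFiniteColimits_tfae.out 3 1 :).1 inferInstance _ ⟨hex, hχ⟩).1
  let ι : S.X₁ ⟶ E := ModuleCat.ofHom (LinearMap.inl A _ _)
  let p₁ : E ⟶ S.X₁ := ModuleCat.ofHom (LinearMap.fst A _ _)
  let p₂ : E ⟶ P.complex.X 0 := ModuleCat.ofHom (LinearMap.snd A _ _)
  have hιχ : ι ≫ χ = S.f := by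
    ext x
    change S.f.hom x + -a₀.hom 0 = _
    rw [map_zero, neg_zero, add_zero]
  obtain ⟨z, hz⟩ := (ShortComplex.moduleCat_exact_iff _).1 hFex ((F.map ι).hom t) (by
    change ((F.map ι) ≫ F.map χ).hom t = 0
    rw [← F.map_comp, hιχ]
    exact ht)
  have hz' : (F.map φ).hom z = (F.map ι).hom t := hz
  have hz₁ : (F.map a₁).hom z = t := by
    have : (F.map φ ≫ F.map p₁).hom z = (F.map ι ≫ F.map p₁).hom t :=
      congrArg (F.map p₁).hom hz'
    rw [← F.map_comp, ← F.map_comp, show φ ≫ p₁ = a₁ from rfl, show ι ≫ p₁ = 𝟙 _ from rfl,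
      F.map_id] at this
    exact this
  have hz₂ : (F.map d).hom z = 0 := by
    have : (F.map φ ≫ F.map p₂).hom z = (F.map ι ≫ F.map p₂).hom t :=
      congrArg (F.map p₂).hom hz'
    rw [← F.map_comp, ← F.map_comp, show φ ≫ p₂ = d from rfl, show ι ≫ p₂ = 0 from rfl,
      F.map_zero] at this
    exact this
  -- The cycle `z` as a morphism from the free module of rank one; its homology class is the
  -- required preimage of `t`.
  let ζ : ModuleCat.of B B ⟶ K.X 1 :=
    ModuleCat.ofHom (LinearMap.toSpanSingleton B (F.obj (P.complex.X 1)) z)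
  have hζ : ζ ≫ K.d 1 0 = 0 := by
    ext
    change (F.map d).hom ((1 : B) • z) = 0
    rw [one_smul, hz₂]
  let c : ModuleCat.of B B ⟶ K.cycles 1 := K.liftCycles ζ 0 (by simp) hζ
  have hc : c ≫ K.homologyπ 1 ≫ K.homologyι 1 ≫ τ' = ζ ≫ b₁ := by
    rw [K.homology_π_ι_assoc, K.liftCycles_i_assoc, K.p_descOpcycles]
  have hce : ((c ≫ K.homologyπ 1) ≫ e.inv) ≫ e.hom ≫ K.homologyι 1 ≫ τ' = ζ ≫ b₁ := by
    rw [Category.assoc, Iso.inv_hom_id_assoc, Category.assoc, hc]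
  refine ⟨((c ≫ K.homologyπ 1) ≫ e.inv).hom (1 : B), ?_⟩
  refine (congrArg (fun f => f.hom (1 : B)) hce).trans ?_
  change (F.map a₁).hom ((1 : B) • z) = t
  rw [one_smul, hz₁]

end Derived

namespace AlgBimodule

attribute [local instance] NCTensor.leftAction NCTensor.rightAction

variable {k : Type v} [CommRing k] {A B : Type u} [Ring A] [Algebra k A] [Ring B] [Algebra k B]

instance (M : AlgBimodule k A B) : Limits.PreservesFiniteColimits M.tensorRightFunctor := by
  refine (M.tensorRightFunctor.preservesFiniteColimits_tfae.out 0 3).1 fun S hS => ?_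
  have hg : Function.Surjective S.g := (ModuleCat.epi_iff_surjective _).1 hS.epi_g
  have hfg := (ShortComplex.ShortExact.moduleCat_exact_iff_function_exact S).1 hS.exact
  constructor
  · rw [ShortComplex.ShortExact.moduleCat_exact_iff_function_exact]
    exact NCTensor.exact_map_left hfg hg
  · rw [ModuleCat.epi_iff_surjective]
    exact NCTensor.map_surjective hg Function.surjective_id

end AlgBimodule

/-! ### Tensoring a map of left factors under the condition `γ`. -/

namespace DimFunction

attribute [local instance] NCTensor.leftAction NCTensor.rightAction

variable {δ : DimFunction.{u}} {n : ℤ} {k : Type v} [CommRing k] {A B : Type u} [Ring A]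
  [Algebra k A] [Ring B] [Algebra k B]

/-- The part of the condition `γ_{n,1}` that concerns tensoring right modules with `M`. -/
def RightGamma (δ : DimFunction.{u}) (n : ℤ) (M : AlgBimodule k A B) : Prop :=
  ∀ N : ModuleCat.{u} Aᵐᵒᵖ, δ.IsSmall n Aᵐᵒᵖ N → ∀ j ≤ 1, δ.IsSmall n Bᵐᵒᵖ (M.torRight j N)

variable {M : AlgBimodule k A B} (hM : δ.RightGamma n M) (hA : δ.IsExact Aᵐᵒᵖ)
  (hB : δ.IsExact Bᵐᵒᵖ)
variable {X Y : Type u} [AddCommGroup X] [Module Aᵐᵒᵖ X] [AddCommGroup Y] [Module Aᵐᵒᵖ Y]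

include hM hB

theorem RightGamma.dim_tensor_le [Module.Finite Aᵐᵒᵖ X]
    (hX : δ Aᵐᵒᵖ X ≤ ((n : ℝ) : EReal)) : δ Bᵐᵒᵖ (NCTensor A X M) ≤ ((n : ℝ) : EReal) := by
  have h := (hM (ModuleCat.of Aᵐᵒᵖ X) ⟨inferInstance, hX⟩ 0 zero_le_one).2
  let e := (M.tensorRightFunctor.leftDerivedZeroIsoSelf.app (ModuleCat.of Aᵐᵒᵖ X)).toLinearEquiv
  exact (hB.le_of_surjective e.toLinearMap e.surjective).trans h

theorem RightGamma.dim_ker_le_of_surjective [IsNoetherianRing Aᵐᵒᵖ] [Module.Finite Aᵐᵒᵖ X]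
    (f : X →ₗ[Aᵐᵒᵖ] Y) (hf : Function.Surjective f)
    (hk : δ Aᵐᵒᵖ (LinearMap.ker f) ≤ ((n : ℝ) : EReal)) :
    δ Bᵐᵒᵖ (LinearMap.ker (NCTensor.rMap (R := A) Bᵐᵒᵖ M f)) ≤ ((n : ℝ) : EReal) := by
  have h := hM.dim_tensor_le hB hk
  refine (hB.submodule_mono ?_).trans
    ((hB.range_le (NCTensor.rMap (R := A) Bᵐᵒᵖ M (LinearMap.ker f).subtype)).trans h)
  intro t ht
  exact (NCTensor.exact_map_left (N := M) (LinearMap.exact_subtype_ker_map f) hf t).1 ht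

/-- The kernel is covered by `Tor₁` of the cokernel of `f`. The surjective case needs only `Tor₀`,
and the general case factors `f` through its range. -/
theorem RightGamma.dim_ker_le_of_injective [Module.Finite Aᵐᵒᵖ Y]
    (f : X →ₗ[Aᵐᵒᵖ] Y) (hf : Function.Injective f)
    (hc : δ Aᵐᵒᵖ (Y ⧸ LinearMap.range f) ≤ ((n : ℝ) : EReal)) :
    δ Bᵐᵒᵖ (LinearMap.ker (NCTensor.rMap (R := A) Bᵐᵒᵖ M f)) ≤ ((n : ℝ) : EReal) := by
  have hS := shortExact_moduleCat hf (LinearMap.exact_map_mkQ_range f) (Submodule.mkQ_surjective _)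
  obtain ⟨τ, hτ⟩ := exists_leftDerived_one_exact M.tensorRightFunctor hS
  exact (hB.submodule_mono hτ).trans ((hB.range_le τ.hom).trans
    (hM (ModuleCat.of Aᵐᵒᵖ (Y ⧸ LinearMap.range f)) ⟨inferInstance, hc⟩ 1 le_rfl).2)

theorem RightGamma.dim_ker_le [IsNoetherianRing Aᵐᵒᵖ] [Module.Finite Aᵐᵒᵖ X]
    [Module.Finite Aᵐᵒᵖ Y] (f : X →ₗ[Aᵐᵒᵖ] Y)
    (hk : δ Aᵐᵒᵖ (LinearMap.ker f) ≤ ((n : ℝ) : EReal))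
    (hc : δ Aᵐᵒᵖ (Y ⧸ LinearMap.range f) ≤ ((n : ℝ) : EReal)) :
    δ Bᵐᵒᵖ (LinearMap.ker (NCTensor.rMap (R := A) Bᵐᵒᵖ M f)) ≤ ((n : ℝ) : EReal) := by
  have h₁ := hM.dim_ker_le_of_surjective hB f.rangeRestrict f.surjective_rangeRestrict
    (by rwa [LinearMap.ker_rangeRestrict])
  have h₂ := hM.dim_ker_le_of_injective hB (LinearMap.range f).subtype
    (LinearMap.range f).injective_subtype (by rwa [Submodule.range_subtype])
  have hf : NCTensor.rMap (R := A) Bᵐᵒᵖ M f =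
      NCTensor.rMap (R := A) Bᵐᵒᵖ M (LinearMap.range f).subtype ∘ₗ
        NCTensor.rMap (R := A) Bᵐᵒᵖ M f.rangeRestrict :=
    NCTensor.linearMap_ext fun _ _ => rfl
  rw [hf]
  exact hB.ker_comp_le _ _ h₁ h₂

theorem RightGamma.dim_coker_le [Module.Finite Aᵐᵒᵖ Y] (f : X →ₗ[Aᵐᵒᵖ] Y)
    (hc : δ Aᵐᵒᵖ (Y ⧸ LinearMap.range f) ≤ ((n : ℝ) : EReal)) :
    δ Bᵐᵒᵖ (NCTensor A Y M ⧸ LinearMap.range (NCTensor.rMap (R := A) Bᵐᵒᵖ M f)) ≤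
      ((n : ℝ) : EReal) := by
  have h := hM.dim_tensor_le hB hc
  refine (hB.le_of_ker_le (Submodule.mkQ _) (Submodule.mkQ_surjective _)
    (NCTensor.rMap (R := A) Bᵐᵒᵖ M (LinearMap.range f).mkQ) ?_).trans ((hB.submodule_le _).trans h)
  rw [Submodule.ker_mkQ]
  intro t ht
  exact (NCTensor.exact_map_left (N := M) (LinearMap.exact_map_mkQ_range f)
    (Submodule.mkQ_surjective _) t).1 ht

end DimFunction

/-! ### The torsion of an invertible bimodule -/

namespace DimFunction.IsExact

variable {δ : DimFunction.{u}} {R : Type u} [Ring R] (h : δ.IsExact R) {e : EReal}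
variable {X X' Y Y' : Type u} [AddCommGroup X] [Module R X] [AddCommGroup X'] [Module R X']
  [AddCommGroup Y] [Module R Y] [AddCommGroup Y'] [Module R Y']

include h

theorem ker_le_of_injective (f : X →ₗ[R] Y) (hf : Function.Injective f) :
    δ R (LinearMap.ker f) ≤ e := by
  have : Subsingleton (LinearMap.ker f) := by
    rw [LinearMap.ker_eq_bot.2 hf]
    infer_instance
  exact h.of_subsingleton

theorem coker_le_of_surjective (f : X →ₗ[R] Y) (hf : Function.Surjective f) :
    δ R (Y ⧸ LinearMap.range f) ≤ e := by
  have : Subsingleton (Y ⧸ LinearMap.range f) :=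
    Submodule.Quotient.subsingleton_iff.2 (LinearMap.range_eq_top.2 hf)
  exact h.of_subsingleton

theorem ker_le_of_square {f : X →ₗ[R] Y} {f' : X' →ₗ[R] Y'} (a : X →ₗ[R] X') (b : Y →ₗ[R] Y')
    (hab : ∀ x, f' (a x) = b (f x)) (ha : δ R (X' ⧸ LinearMap.range a) ≤ e)
    (hb : δ R (LinearMap.ker b) ≤ e) (hf : δ R (LinearMap.ker f) ≤ e) :
    δ R (LinearMap.ker f') ≤ e := by
  refine h.ker_le_of_comp_of_coker a f' ha ?_
  rw [show f' ∘ₗ a = b ∘ₗ f from LinearMap.ext hab]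
  exact h.ker_comp_le f b hf hb

theorem ker_le_of_square' {f : X →ₗ[R] Y} {f' : X' →ₗ[R] Y'} (a : X →ₗ[R] X') (b : Y →ₗ[R] Y')
    (hab : ∀ x, f' (a x) = b (f x)) (ha : δ R (LinearMap.ker a) ≤ e)
    (hf' : δ R (LinearMap.ker f') ≤ e) : δ R (LinearMap.ker f) ≤ e := by
  refine h.ker_le_of_comp f b ?_
  rw [← show f' ∘ₗ a = b ∘ₗ f from LinearMap.ext hab]
  exact h.ker_comp_le a f' ha hf'

end DimFunction.IsExact

namespace NCTensor

theorem exists_sum_tmul {R M N : Type u} [Ring R] [AddCommGroup M] [Module Rᵐᵒᵖ M] [AddCommGroup N]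
    [Module R N] {n : ℕ} {y : Fin n → N} (hy : Submodule.span R (Set.range y) = ⊤)
    (t : NCTensor R M N) : ∃ a : Fin n → M, t = ∑ i, tmul R (a i) (y i) := by
  induction t using induction_on with
  | tmul m x =>
    obtain ⟨c, rfl⟩ := (Submodule.mem_span_range_iff_exists_fun R).1
      (hy ▸ Submodule.mem_top : x ∈ Submodule.span R (Set.range y))
    refine ⟨fun i => MulOpposite.op (c i) • m, ?_⟩
    rw [← tmulHom_apply, map_sum]
    exact Finset.sum_congr rfl fun i _ => (smul_tmul (c i) m (y i)).symm
  | add s t hs ht =>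
    obtain ⟨a, rfl⟩ := hs
    obtain ⟨b, rfl⟩ := ht
    exact ⟨a + b, by simp [add_tmul, Finset.sum_add_distrib]⟩

end NCTensor

/-! ### The torsion after tensoring with the inverse bimodule. -/

namespace DimFunction

attribute [local instance] NCTensor.leftAction NCTensor.rightAction

variable {δ : DimFunction.{u}} {A B : Type u} [Ring A] [Ring B] {k : Type v}
  {κA : k → A} {κB : k → Bᵐᵒᵖ}
variable {T T' : Type u} [AddCommGroup T] [Module A T] [Module Bᵐᵒᵖ T] [SMulCommClass A Bᵐᵒᵖ T]
  [SMulCommClass Bᵐᵒᵖ A T] [AddCommGroup T'] [Module B T'] [Module Aᵐᵒᵖ T']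
  [SMulCommClass B Aᵐᵒᵖ T'] [SMulCommClass Aᵐᵒᵖ B T']

/-- The kernel has small left dimension in the weak sense `e'`, which suffices to keep its image in
`P` away from `A`. It is then bounded by `ker f` and the cokernel of `g`, which gives the stronger
bound `e` on the right. -/
theorem dim_ker_mkQ_torsion_tensor (hA : δ.IsExact A) (hA' : δ.IsExact Aᵐᵒᵖ)
    (hB' : δ.IsExact Bᵐᵒᵖ) [IsNoetherianRing Bᵐᵒᵖ] [Module.Finite Bᵐᵒᵖ T] [Module.Finite B T']
    (hs : δ.IsSymmetricPair κB κA) (hk : ∀ (c : k) (t : T), κB c • t = κA c • t)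
    {e e' : EReal} (hee' : e ≤ e')
    (hAtf : TorsionFree δ e' A A) (hAtf' : TorsionFree δ e' Aᵐᵒᵖ A)
    {P : Type u} [AddCommGroup P] [Module A P] [Module Aᵐᵒᵖ P]
    (f : NCTensor B T T' →ₗ[Aᵐᵒᵖ] P) (hfl : ∀ (a : A) (x : NCTensor B T T'), f (a • x) = a • f x)
    (g : A →ₗ[Aᵐᵒᵖ] P) (hgl : ∀ (a x : A), g (a • x) = a • g x)
    (hf : δ Aᵐᵒᵖ (LinearMap.ker f) ≤ e) (hgk : δ Aᵐᵒᵖ (LinearMap.ker g) ≤ e)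
    (hgc : δ Aᵐᵒᵖ (P ⧸ LinearMap.range g) ≤ e) :
    δ Aᵐᵒᵖ (LinearMap.ker (NCTensor.rMap (R := B) Aᵐᵒᵖ T' (torsion δ e' Bᵐᵒᵖ T).mkQ)) ≤ e := by
  let N := torsion δ e' Bᵐᵒᵖ T
  let K := LinearMap.ker (NCTensor.rMap (R := B) Aᵐᵒᵖ T' N.mkQ)
  have hginj : Function.Injective g := LinearMap.ker_eq_bot.1 (hAtf' _ (hgk.trans hee'))
  let := N.stableModule (R := A) (smul_mem_torsion hB')
  have : SMulCommClass A Bᵐᵒᵖ N := ⟨fun a b x => Subtype.ext (smul_comm a b x.1)⟩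
  have hN : δ A N ≤ e' :=
    ((hs N fun c x => Subtype.ext (hk c x.1)).1 inferInstance).trans hB'.torsion_le
  obtain ⟨r, y, hy⟩ := Module.Finite.exists_fin (R := B) (M := T')
  -- Generators of `T'` over `B` cover the image of `N ⊗ T'` by a power of `N`, linearly for the
  -- left action of `A`.
  let Λ : (Fin r → N) →ₗ[A] P :=
    { toFun := fun a => ∑ i, f (NCTensor.tmul B (a i).1 (y i))
      map_add' := fun a b => by
        rw [← Finset.sum_add_distrib]
        refine Finset.sum_congr rfl fun i _ => ?_
        rw [← map_add, ← NCTensor.add_tmul]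
        rfl
      map_smul' := fun c a => by
        rw [RingHom.id_apply, Finset.smul_sum]
        exact Finset.sum_congr rfl fun i _ => hfl c (NCTensor.tmul B (a i).1 (y i)) }
  have hΛ : δ A (LinearMap.range Λ) ≤ e' := (hA.range_le Λ).trans (hA.pi_le hN r)
  have hKΛ : ∀ t ∈ K, f t ∈ LinearMap.range Λ := by
    intro t ht
    obtain ⟨s, rfl⟩ := (NCTensor.exact_map_left (N := T') (LinearMap.exact_subtype_mkQ N)
      N.mkQ_surjective t).1 ht
    obtain ⟨a, rfl⟩ := NCTensor.exists_sum_tmul hy s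
    exact ⟨a, by rw [map_sum, map_sum]; rfl⟩
  let gl : A →ₗ[A] P := { toFun := g, map_add' := map_add g, map_smul' := hgl }
  -- The intersection of `range Λ` with the copy of `A` is a left ideal of dimension at most `e'`.
  have hJ : (LinearMap.range Λ).comap gl = ⊥ := by
    refine hAtf _ ((hA.le_of_injective ((gl ∘ₗ ((LinearMap.range Λ).comap gl).subtype).codRestrict
      (LinearMap.range Λ) fun x => x.2) fun x y hxy => ?_).trans hΛ)
    exact Subtype.ext (hginj (congrArg Subtype.val hxy))
  refine hA'.le_of_ker_range ((LinearMap.range g).mkQ ∘ₗ f ∘ₗ K.subtype) ?_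
    ((hA'.submodule_le _).trans hgc)
  refine (hA'.le_of_injective ((K.subtype ∘ₗ (LinearMap.ker ((LinearMap.range g).mkQ ∘ₗ f ∘ₗ
    K.subtype)).subtype).codRestrict (LinearMap.ker f) ?_) ?_).trans hf
  · rintro ⟨⟨t, ht⟩, htg⟩
    obtain ⟨b, hb⟩ : f t ∈ LinearMap.range g := (Submodule.Quotient.mk_eq_zero _).1 htg
    have hbJ : b ∈ (LinearMap.range Λ).comap gl := by
      change g b ∈ LinearMap.range Λ
      rw [hb]
      exact hKΛ t ht
    rw [hJ, Submodule.mem_bot] at hbJ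
    change f t = 0
    rw [← hb, hbJ, map_zero]
  · intro x y hxy
    have hval := congrArg Subtype.val hxy
    exact Subtype.ext (Subtype.ext hval)

/-- A right module map whose kernel becomes small after tensoring with `T' ⊗ T` has small kernel,
if `T' ⊗ T` is isomorphic to `B` up to small modules. -/
theorem dim_ker_le_of_tensor (hB' : δ.IsExact Bᵐᵒᵖ) [IsNoetherianRing Bᵐᵒᵖ]
    {X Y : Type u} [AddCommGroup X] [Module Bᵐᵒᵖ X] [AddCommGroup Y] [Module Bᵐᵒᵖ Y]
    [Module.Finite Bᵐᵒᵖ X] [Module.Finite Bᵐᵒᵖ Y] (π : X →ₗ[Bᵐᵒᵖ] Y) {e : EReal}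
    {P : Type u} [AddCommGroup P] [Module B P] [Module Bᵐᵒᵖ P] [SMulCommClass B Bᵐᵒᵖ P]
    (f : NCTensor A T' T →ₗ[Bᵐᵒᵖ] P) (hfl : ∀ (b : B) (x : NCTensor A T' T), f (b • x) = b • f x)
    (g : B →ₗ[Bᵐᵒᵖ] P) (hgl : ∀ (b x : B), g (b • x) = b • g x)
    (hfk : δ Bᵐᵒᵖ (LinearMap.ker f) ≤ e) (hfc : δ Bᵐᵒᵖ (P ⧸ LinearMap.range f) ≤ e)
    (hgk : δ Bᵐᵒᵖ (LinearMap.ker g) ≤ e) (hgc : δ Bᵐᵒᵖ (P ⧸ LinearMap.range g) ≤ e)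
    (h : δ Bᵐᵒᵖ (LinearMap.ker (NCTensor.rMap (R := A) Bᵐᵒᵖ T
      (NCTensor.rMap (R := B) Aᵐᵒᵖ T' π))) ≤ e) : δ Bᵐᵒᵖ (LinearMap.ker π) ≤ e := by
  have : SMulCommClass Bᵐᵒᵖ B P := SMulCommClass.symm _ _ _
  have h₁ : δ Bᵐᵒᵖ (LinearMap.ker (NCTensor.rMap (R := B) Bᵐᵒᵖ (NCTensor A T' T) π)) ≤ e :=
    hB'.ker_le_of_square (NCTensor.assoc B A Bᵐᵒᵖ X T' T).toLinearMap
      (NCTensor.assoc B A Bᵐᵒᵖ Y T' T).toLinearMap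
      (fun t => (NCTensor.assoc_rMap_rMap π t).symm)
      (hB'.coker_le_of_surjective _ (NCTensor.assoc B A Bᵐᵒᵖ X T' T).surjective)
      (hB'.ker_le_of_injective _ (NCTensor.assoc B A Bᵐᵒᵖ Y T' T).injective) h
  let f' : NCTensor A T' T →ₗ[B] P := { toFun := f, map_add' := map_add f, map_smul' := hfl }
  let g' : B →ₗ[B] P := { toFun := g, map_add' := map_add g, map_smul' := hgl }
  -- Moving forward along `f` uses both its kernel and its cokernel. The last step pulls back along
  -- `g` and identifies `X ⊗ B` with `X`.
  have h₂ : δ Bᵐᵒᵖ (LinearMap.ker (NCTensor.rMap (R := B) Bᵐᵒᵖ P π)) ≤ e :=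
    hB'.ker_le_of_square _ _
      (fun t => DFunLike.congr_fun (NCTensor.linearMap_ext (Q := Bᵐᵒᵖ)
        (φ := NCTensor.rMap Bᵐᵒᵖ P π ∘ₗ NCTensor.lMap X f' (fun q n => map_smul f q n))
        (ψ := NCTensor.lMap Y f' (fun q n => map_smul f q n) ∘ₗ NCTensor.rMap Bᵐᵒᵖ _ π)
        fun _ _ => rfl) t)
      (NCTensor.dim_coker_lMap_le hB' f' f (fun _ => rfl) hfc)
      (NCTensor.dim_ker_lMap_le hB' f' f (fun _ => rfl) hfk hfc) h₁
  refine hB'.ker_le_of_square'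
    (NCTensor.lMap X g' (fun q n => map_smul g q n) ∘ₗ (NCTensor.unit B X).toLinearMap)
    (NCTensor.lMap Y g' (fun q n => map_smul g q n) ∘ₗ (NCTensor.unit B Y).toLinearMap)
    (fun x => rfl) (hB'.ker_comp_le _ _
      (hB'.ker_le_of_injective _ (NCTensor.unit B X).injective)
      (NCTensor.dim_ker_lMap_le hB' g' g (fun _ => rfl) hgk hgc)) h₂

end DimFunction

/-! ### The dualizing condition and the symmetry condition for algebras -/

namespace DimFunction

section Dualizing

variable {δ : DimFunction.{u}} {d : ℕ} {A : Type u} [Ring A] [IsNoetherianRing A]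
  [IsNoetherianRing Aᵐᵒᵖ]

/-- The ring `A` as a free right module over itself. -/
def opSelfEquiv (A : Type u) [Ring A] : Aᵐᵒᵖ ≃ₗ[Aᵐᵒᵖ] A where
  toFun := MulOpposite.unop
  invFun := MulOpposite.op
  map_add' _ _ := rfl
  map_smul' _ _ := rfl
  left_inv _ := rfl
  right_inv _ := rfl

/-- Duals of left modules are right modules, so the Auslander condition enters on the opposite side.
-/
theorem isDualizing_left (h : δ.IsExact A) (hAG : IsAuslanderGorenstein A)
    (hCM : IsCohenMacaulayOfDim δ A d) : δ.IsDualizing d A Aᵐᵒᵖ A where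
  exact := h
  noeth_left := inferInstance
  noeth_right := inferInstance
  finite_left := inferInstance
  finite_right := Module.Finite.equiv (opSelfEquiv A)
  free_right := Module.Free.of_equiv (opSelfEquiv A)
  eq_smul f := ⟨f 1, fun x => by
    conv_lhs => rw [show x = MulOpposite.op x • (1 : A) from (one_mul x).symm, map_smul]
    rfl⟩
  eq_zero_of_smul a ha := by simpa using ha 1
  grade_add_dim M _ _ := hCM.2.1 M
  auslander M _ _ := hAG.2.2 M

theorem isDualizing_right (h : δ.IsExact Aᵐᵒᵖ) (hAG : IsAuslanderGorenstein A)
    (hCM : IsCohenMacaulayOfDim δ A d) : δ.IsDualizing d Aᵐᵒᵖ A A where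
  exact := h
  noeth_left := inferInstance
  noeth_right := inferInstance
  finite_left := Module.Finite.equiv (opSelfEquiv A)
  finite_right := inferInstance
  free_right := inferInstance
  eq_smul f := ⟨MulOpposite.op (f 1), fun x => by
    conv_lhs => rw [show x = x • (1 : A) from (mul_one x).symm, map_smul]
    rfl⟩
  eq_zero_of_smul a ha := by simpa using ha 1
  grade_add_dim M _ _ := hCM.2.2 M
  auslander M _ _ := hAG.2.1 M

end Dualizing

variable {δ : DimFunction.{u}} {k : Type v} [CommRing k] {A B : Type u} [Ring A] [Algebra k A]
  [Ring B] [Algebra k B]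

theorem IsSymmetric.isSymmetricPair (h : δ.IsSymmetric k A B) :
    δ.IsSymmetricPair (fun c : k => MulOpposite.op (algebraMap k B c)) (algebraMap k A) := by
  intro M _ _ _ _ hM
  exact h { carrier := M, central := fun c m => (hM c m).symm }

theorem SatisfiesGamma.rightGamma {n : ℤ} (h : δ.SatisfiesGamma k A B n 1) {M : AlgBimodule k A B}
    (hM : M.IsFG) : δ.RightGamma n M := (h M hM).1

end DimFunction

/-! ### Reflexive hulls of invertible bimodules -/

namespace AlgBimodule

attribute [local instance] NCTensor.leftAction NCTensor.rightAction

variable {δ : DimFunction.{u}} {d : ℕ} {k : Type v} [CommRing k] {A B : Type u} [Ring A]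
  [Algebra k A] [Ring B] [Algebra k B]

/-- `T ⊗ T' ≈ A` makes the kernel of `T ⊗ T' → (T/N) ⊗ T'` small; condition `γ` keeps it small after
tensoring with `T`; `T' ⊗ T ≈ B` then recovers the kernel `N` of `T → T/N`. -/
theorem dim_torsion_le_of_nIsomorphic [IsNoetherianRing A] [IsNoetherianRing Aᵐᵒᵖ]
    [IsNoetherianRing Bᵐᵒᵖ]
    (hA : δ.IsExact A) (hA' : δ.IsExact Aᵐᵒᵖ) (hB' : δ.IsExact Bᵐᵒᵖ) (hs : δ.IsSymmetric k A B)
    (hγ : δ.SatisfiesGamma k A B ((d : ℤ) - 2) 1)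
    (hAG : IsAuslanderGorenstein A) (hCM : IsCohenMacaulayOfDim δ A d)
    {T : AlgBimodule k A B} {T' : AlgBimodule k B A} (hT : T.IsFG) (hT' : T'.IsFG)
    (hTT' : (T.tensor T').NIsomorphic δ ((d : ℤ) - 2) (AlgBimodule.regular k A))
    (hT'T : (T'.tensor T).NIsomorphic δ ((d : ℤ) - 2) (AlgBimodule.regular k B)) :
    δ Bᵐᵒᵖ (DimFunction.torsion δ (DimFunction.codim d 1) Bᵐᵒᵖ T) ≤ DimFunction.codim d 2 := by
  obtain ⟨P, f, g, hf, hg⟩ := hTT'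
  obtain ⟨P', f', g', hf', hg'⟩ := hT'T
  have := hT.1
  have := hT.2
  have := hT'.1
  have := hT'.2
  let F : NCTensor B T T' →ₗ[Aᵐᵒᵖ] P := f.toLinearMap
  let G : A →ₗ[Aᵐᵒᵖ] P := g.toLinearMap
  let F' : NCTensor A T' T →ₗ[Bᵐᵒᵖ] P' := f'.toLinearMap
  let G' : B →ₗ[Bᵐᵒᵖ] P' := g'.toLinearMap
  have hker := DimFunction.dim_ker_mkQ_torsion_tensor (T := T) (T' := T') hA hA' hB'
    hs.isSymmetricPair (fun c t => (T.central c t).symm)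
    (DimFunction.codim_anti d one_le_two)
    (DimFunction.isDualizing_left hA hAG hCM).torsionFree_self
    (DimFunction.isDualizing_right hA' hAG hCM).torsionFree_self F f.map_left_smul
    G g.map_left_smul hf.1 hg.1 hg.2
  have : Module.Finite Aᵐᵒᵖ (NCTensor B T T') := NCTensor.finite_right
  have hker₂ := (hγ.rightGamma hT).dim_ker_le_of_surjective hB' _
    (NCTensor.map_surjective (Submodule.mkQ_surjective _) Function.surjective_id) hker
  have h := DimFunction.dim_ker_le_of_tensor hB' _ F' f'.map_left_smul G' g'.map_left_smul
    hf'.1 hf'.2 hg'.1 hg'.2 hker₂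
  rwa [Submodule.ker_mkQ] at h

end AlgBimodule

namespace AlgBimodule

open DimFunction

variable {δ : DimFunction.{u}} {d : ℕ} {k : Type v} [CommRing k] {A B : Type u} [Ring A]
  [Algebra k A] [Ring B] [Algebra k B]

/-- `U` is the right double dual of `T/N`. The kernel of `T → U` is `N`, and its cokernel is that of
the evaluation map. -/
theorem exists_hom_isReflexiveOnBothSides [IsNoetherianRing A] [IsNoetherianRing Aᵐᵒᵖ]
    [IsNoetherianRing B] [IsNoetherianRing Bᵐᵒᵖ]
    (hA : δ.IsExact A) (hB' : δ.IsExact Bᵐᵒᵖ) (hs : δ.IsSymmetric k A B)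
    (hAG : IsAuslanderGorenstein A) (hCM : IsCohenMacaulayOfDim δ A d)
    (hAG' : IsAuslanderGorenstein B) (hCM' : IsCohenMacaulayOfDim δ B d)
    {T : AlgBimodule k A B} (hT : T.IsFG)
    (hN : δ Bᵐᵒᵖ (torsion δ (codim d 1) Bᵐᵒᵖ T) ≤ codim d 2) :
    ∃ (U : AlgBimodule k A B) (f : Hom T U),
      U.IsFG ∧ U.IsReflexiveOnBothSides ∧ f.IsNIso δ ((d : ℤ) - 2) := by
  have := hT.1
  have := hT.2
  let N := torsion δ (codim d 1) Bᵐᵒᵖ T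
  let := N.quotientStableModule (R := A) (smul_mem_torsion hB')
  have : SMulCommClass A Bᵐᵒᵖ (T ⧸ N) := ⟨fun a b x => by
    obtain ⟨x, rfl⟩ := Submodule.Quotient.mk_surjective _ x
    exact congrArg Submodule.Quotient.mk (smul_comm a b x)⟩
  let π : T →ₗ[A] T ⧸ N :=
    { toFun := Submodule.Quotient.mk, map_add' := fun _ _ => rfl, map_smul' := fun _ _ => rfl }
  have : Module.Finite A (T ⧸ N) :=
    Module.Finite.of_surjective π (Submodule.Quotient.mk_surjective _)
  have htf : TorsionFree δ (codim d 1) Bᵐᵒᵖ (T ⧸ N) := hB'.torsionFree_quotient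
  have hk : ∀ (c : k) (x : T ⧸ N), MulOpposite.op (algebraMap k B c) • x = algebraMap k A c • x := by
    intro c x
    obtain ⟨x, rfl⟩ := Submodule.Quotient.mk_surjective _ x
    exact congrArg Submodule.Quotient.mk (T.central c x).symm
  have hDB := isDualizing_right hB' hAG' hCM'
  have hDA := isDualizing_left hA hAG hCM
  have hcB : ∀ (c : k) (x : B), MulOpposite.op (algebraMap k B c) • x = algebraMap k B c • x :=
    fun c x => (Algebra.commutes c x).symm
  have hcA : ∀ (c : k) (x : A), algebraMap k A c • x = MulOpposite.op (algebraMap k A c) • x :=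
    fun c x => Algebra.commutes c x
  let U : AlgBimodule k A B :=
    { carrier := DoubleDual Bᵐᵒᵖ B B (T ⧸ N)
      central := fun c F => (IsDualizing.central_doubleDual hcB hk c F).symm }
  let f : Hom T U :=
    { toLinearMap := DoubleDual.eval Bᵐᵒᵖ B B (T ⧸ N) ∘ₗ N.mkQ
      map_left_smul := fun a x => rfl }
  have hrefl := hDB.isReflexiveModule_doubleDual (M := T ⧸ N)
  have hrefl' := hDB.isReflexiveModule_otherSide hDA hs.isSymmetricPair hcB hcA hk htf
  refine ⟨U, f, ⟨hrefl'.1, hrefl.1⟩, ⟨hrefl', hrefl⟩, ?_, ?_⟩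
  · refine hB'.ker_comp_le N.mkQ _ ?_ (hB'.ker_le_of_injective _ (hDB.eval_injective htf))
    rw [Submodule.ker_mkQ]
    exact hN
  · refine hB'.coker_comp_le N.mkQ _ ?_ hDB.dim_coker_eval_le
    exact hB'.coker_le_of_surjective _ (Submodule.Quotient.mk_surjective _)

end AlgBimodule

/-! ### Isomorphisms up to small modules -/

namespace DimFunction.IsExact

variable {δ : DimFunction.{u}} {R : Type u} [Ring R] (h : δ.IsExact R) {e : EReal}
variable {X Y P Q : Type u} [AddCommGroup X] [Module R X] [AddCommGroup Y] [Module R Y]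
  [AddCommGroup P] [Module R P] [AddCommGroup Q] [Module R Q]
  {f : X →ₗ[R] Y} {g : X →ₗ[R] P} {i : Y →ₗ[R] Q} {j : P →ₗ[R] Q}

include h

theorem pushout_ker_le (hex : ∀ y p, i y = j p → ∃ x, f x = y ∧ g x = p)
    (hf : δ R (LinearMap.ker f) ≤ e) : δ R (LinearMap.ker j) ≤ e := by
  refine (h.submodule_mono ?_).trans
    ((h.range_le (g ∘ₗ (LinearMap.ker f).subtype)).trans hf)
  intro p hp
  obtain ⟨x, hx, rfl⟩ := hex 0 p (by rw [map_zero, LinearMap.mem_ker.1 hp])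
  exact ⟨⟨x, hx⟩, rfl⟩

theorem pushout_coker_le (hcomm : ∀ x, i (f x) = j (g x)) (hsurj : ∀ q, ∃ y p, q = i y + j p)
    (hf : δ R (Y ⧸ LinearMap.range f) ≤ e) : δ R (Q ⧸ LinearMap.range j) ≤ e := by
  refine (h.le_of_ker_le ((LinearMap.range j).mkQ ∘ₗ i) ?_ (LinearMap.range f).mkQ ?_).trans
    ((h.submodule_le _).trans hf)
  · intro q
    obtain ⟨q, rfl⟩ := Submodule.Quotient.mk_surjective _ q
    obtain ⟨y, p, rfl⟩ := hsurj q
    refine ⟨y, ((Submodule.Quotient.eq _).2 ?_).symm⟩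
    exact ⟨p, by rw [add_sub_cancel_left]⟩
  · rw [Submodule.ker_mkQ]
    rintro _ ⟨x, rfl⟩
    exact (Submodule.Quotient.mk_eq_zero _).2 ⟨g x, (hcomm x).symm⟩

end DimFunction.IsExact

namespace NCTensor

attribute [local instance] NCTensor.leftAction

theorem map_smul_left {R S M M' N N' : Type u} [Ring R] [Ring S] [AddCommGroup M] [Module Rᵐᵒᵖ M]
    [Module S M] [SMulCommClass S Rᵐᵒᵖ M] [AddCommGroup M'] [Module Rᵐᵒᵖ M'] [Module S M']
    [SMulCommClass S Rᵐᵒᵖ M'] [AddCommGroup N] [Module R N] [AddCommGroup N'] [Module R N']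
    {f : M →ₗ[Rᵐᵒᵖ] M'} (hf : ∀ (s : S) (m : M), f (s • m) = s • f m) (g : N →ₗ[R] N') (s : S)
    (t : NCTensor R M N) : map f g (s • t) = s • map f g t := by
  induction t using induction_on with
  | tmul m n => exact congrArg (fun z => tmul R z (g n)) (hf s m)
  | add t t' ht ht' => rw [smul_add, map_add, ht, ht', map_add, smul_add]

end NCTensor

namespace AlgBimodule

open DimFunction

variable {δ : DimFunction.{u}} {n : ℤ} {k : Type v} [CommRing k] {A B C : Type u} [Ring A]
  [Algebra k A] [Ring B] [Algebra k B] [Ring C] [Algebra k C]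

/-- The composition of bimodule morphisms. -/
def Hom.comp {X Y Z : AlgBimodule k A B} (g : Hom Y Z) (f : Hom X Y) : Hom X Z where
  toLinearMap := g.toLinearMap ∘ₗ f.toLinearMap
  map_left_smul a x := (congrArg g.toFun (f.map_left_smul a x)).trans (g.map_left_smul a _)

theorem Hom.IsNIso.comp (hB : δ.IsExact Bᵐᵒᵖ) {X Y Z : AlgBimodule k A B} {g : Hom Y Z}
    {f : Hom X Y} (hg : g.IsNIso δ n) (hf : f.IsNIso δ n) : (g.comp f).IsNIso δ n :=
  ⟨hB.ker_comp_le f.toLinearMap g.toLinearMap hf.1 hg.1,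
    hB.coker_comp_le f.toLinearMap g.toLinearMap hf.2 hg.2⟩

/-- In a pushout square, the kernel of each new map is an image of the kernel of the opposite one,
and its cokernel is a quotient of the opposite cokernel. -/
theorem exists_pushout (hB : δ.IsExact Bᵐᵒᵖ) {X Y P : AlgBimodule k A B} {f : Hom X Y}
    {g : Hom X P} (hf : f.IsNIso δ n) (hg : g.IsNIso δ n) :
    ∃ (Q : AlgBimodule k A B) (i : Hom Y Q) (j : Hom P Q), i.IsNIso δ n ∧ j.IsNIso δ n := by
  let w : X →ₗ[Bᵐᵒᵖ] Y × P := f.toLinearMap.prod (-g.toLinearMap)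
  let W := LinearMap.range w
  have hst : ∀ (a : A), ∀ m ∈ W, a • m ∈ W := by
    rintro a _ ⟨x, rfl⟩
    refine ⟨a • x, Prod.ext (f.map_left_smul a x) ?_⟩
    exact (congrArg Neg.neg (g.map_left_smul a x)).trans (smul_neg a _).symm
  let := W.quotientStableModule (R := A) hst
  have : SMulCommClass A Bᵐᵒᵖ ((Y × P) ⧸ W) := ⟨fun a b x => by
    obtain ⟨x, rfl⟩ := Submodule.Quotient.mk_surjective _ x
    exact congrArg Submodule.Quotient.mk (smul_comm a b x)⟩
  let Q : AlgBimodule k A B :=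
    { carrier := (Y × P) ⧸ W
      central := fun c x => by
        obtain ⟨x, rfl⟩ := Submodule.Quotient.mk_surjective _ x
        exact congrArg Submodule.Quotient.mk
          (Prod.ext (Y.central c x.1) (P.central c x.2)) }
  let i : Hom Y Q :=
    { toLinearMap := W.mkQ ∘ₗ LinearMap.inl Bᵐᵒᵖ Y P
      map_left_smul := fun a y => congrArg Submodule.Quotient.mk
        (Prod.ext rfl (smul_zero a).symm) }
  let j : Hom P Q :=
    { toLinearMap := W.mkQ ∘ₗ LinearMap.inr Bᵐᵒᵖ Y P
      map_left_smul := fun a y => congrArg Submodule.Quotient.mk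
        (Prod.ext (smul_zero a).symm rfl) }
  have hex : ∀ y p, i.toLinearMap y = j.toLinearMap p →
      ∃ x, f.toLinearMap x = y ∧ g.toLinearMap x = p := by
    intro y p hyp
    obtain ⟨x, hx⟩ := (Submodule.Quotient.eq W).1 hyp
    have h₁ : f.toLinearMap x = y - 0 := congrArg Prod.fst hx
    have h₂ : -g.toLinearMap x = 0 - p := congrArg Prod.snd hx
    rw [sub_zero] at h₁
    rw [zero_sub, neg_inj] at h₂
    exact ⟨x, h₁, h₂⟩
  have hcomm : ∀ x, i.toLinearMap (f.toLinearMap x) = j.toLinearMap (g.toLinearMap x) := by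
    intro x
    refine (Submodule.Quotient.eq W).2 ⟨x, Prod.ext (sub_zero _).symm (zero_sub _).symm⟩
  have hsurj : ∀ q : Q, ∃ y p, q = i.toLinearMap y + j.toLinearMap p := by
    intro q
    obtain ⟨⟨y, p⟩, rfl⟩ := Submodule.Quotient.mk_surjective _ q
    exact ⟨y, p, congrArg Submodule.Quotient.mk (Prod.ext (add_zero y).symm (zero_add p).symm)⟩
  refine ⟨Q, i, j, ⟨?_, ?_⟩, ⟨?_, ?_⟩⟩
  · refine hB.pushout_ker_le (f := g.toLinearMap) (g := f.toLinearMap) (i := j.toLinearMap) ?_ hg.1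
    intro p y hpy
    obtain ⟨x, hx, hx'⟩ := hex y p hpy.symm
    exact ⟨x, hx', hx⟩
  · refine hB.pushout_coker_le (fun x => (hcomm x).symm) (fun q => ?_) hg.2
    obtain ⟨y, p, hq⟩ := hsurj q
    exact ⟨p, y, hq.trans (add_comm _ _)⟩
  · exact hB.pushout_ker_le hex hf.1
  · exact hB.pushout_coker_le hcomm hsurj hf.2

theorem NIsomorphic.of_isNIso (hB : δ.IsExact Bᵐᵒᵖ) {X Y Z : AlgBimodule k A B} {f : Hom X Y}
    (hf : f.IsNIso δ n) (hXZ : X.NIsomorphic δ n Z) : Y.NIsomorphic δ n Z := by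
  obtain ⟨P, g, h, hg, hh⟩ := hXZ
  obtain ⟨Q, i, j, hi, hj⟩ := exists_pushout hB hf hg
  exact ⟨Q, i, j.comp h, hi, hj.comp hB hh⟩

/-! ### Tensor products of maps with small kernel and cokernel. -/

section Tensor

attribute [local instance] NCTensor.leftAction NCTensor.rightAction

/-- The functoriality of the tensor product of bimodules. -/
def Hom.tensor {X X' : AlgBimodule k A B} {Y Y' : AlgBimodule k B C} (f : Hom X X')
    (g : Hom Y Y') : Hom (X.tensor Y) (X'.tensor Y') where
  toLinearMap := NCTensor.lMap (R := B) (Q := Cᵐᵒᵖ) X'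
      { g.toLinearMap with map_smul' := g.map_left_smul }
      (fun c y => map_smul g.toLinearMap c y) ∘ₗ NCTensor.rMap (R := B) Cᵐᵒᵖ Y f.toLinearMap
  map_left_smul a t :=
    (congrArg (NCTensor.map LinearMap.id { g.toLinearMap with map_smul' := g.map_left_smul })
      (NCTensor.map_smul_left f.map_left_smul LinearMap.id a t)).trans
        (NCTensor.map_smul_left (f := LinearMap.id) (fun _ _ => rfl) _ a _)

/-- Factor through `X' ⊗ Y`. Only the map `f ⊗ Y` calls for condition `γ`; for `X' ⊗ g` a
presentation of `X'` suffices. -/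
theorem Hom.IsNIso.tensor [IsNoetherianRing Bᵐᵒᵖ] (hC : δ.IsExact Cᵐᵒᵖ)
    {X X' : AlgBimodule k A B} {Y Y' : AlgBimodule k B C} {f : Hom X X'} {g : Hom Y Y'}
    (hf : f.IsNIso δ n) (hg : g.IsNIso δ n) (hY : δ.RightGamma n Y)
    [Module.Finite Bᵐᵒᵖ X] [Module.Finite Bᵐᵒᵖ X'] : (f.tensor g).IsNIso δ n := by
  let g' : Y →ₗ[B] Y' := { g.toLinearMap with map_smul' := g.map_left_smul }
  have hr := hY.dim_ker_le hC f.toLinearMap hf.1 hf.2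
  have hr' := hY.dim_coker_le hC f.toLinearMap hf.2
  have hl := NCTensor.dim_ker_lMap_le (M := X') hC g' g.toLinearMap (fun _ => rfl) hg.1 hg.2
  have hl' := NCTensor.dim_coker_lMap_le (M := X') hC g' g.toLinearMap (fun _ => rfl) hg.2
  exact ⟨hC.ker_comp_le _ _ hr hl, hC.coker_comp_le _ _ hr' hl'⟩

end Tensor

end AlgBimodule

theorem proposition3p9 {k : Type v} [CommRing k]
    {B₁ B₂ : Type u} [Ring B₁] [Algebra k B₁] [Ring B₂] [Algebra k B₂]
    [IsNoetherianRing B₁] [IsNoetherianRing B₁ᵐᵒᵖ]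
    [IsNoetherianRing B₂] [IsNoetherianRing B₂ᵐᵒᵖ]
    (δ : DimFunction.{u}) (d : ℕ)
    (hex₁l : δ.IsExact B₁) (hex₁r : δ.IsExact B₁ᵐᵒᵖ)
    (hex₂l : δ.IsExact B₂) (hex₂r : δ.IsExact B₂ᵐᵒᵖ)
    (hsymm₁₂ : δ.IsSymmetric k B₁ B₂) (hsymm₂₁ : δ.IsSymmetric k B₂ B₁)
    (hγ₁₂ : δ.SatisfiesGamma k B₁ B₂ ((d : ℤ) - 2) 1)
    (hγ₂₁ : δ.SatisfiesGamma k B₂ B₁ ((d : ℤ) - 2) 1)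
    (hAG₁ : IsAuslanderGorenstein B₁) (hAG₂ : IsAuslanderGorenstein B₂)
    (hCM₁ : IsCohenMacaulayOfDim δ B₁ d) (hCM₂ : IsCohenMacaulayOfDim δ B₂ d)
    (T : AlgBimodule k B₁ B₂) (T' : AlgBimodule k B₂ B₁) (hT : T.IsFG) (hT' : T'.IsFG)
    (hTT' : (T.tensor T').NIsomorphic δ ((d : ℤ) - 2) (AlgBimodule.regular k B₁))
    (hT'T : (T'.tensor T).NIsomorphic δ ((d : ℤ) - 2) (AlgBimodule.regular k B₂)) :
    ∃ (U : AlgBimodule k B₁ B₂) (V : AlgBimodule k B₂ B₁),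
      U.IsFG ∧ V.IsFG ∧ U.IsReflexiveOnBothSides ∧ V.IsReflexiveOnBothSides ∧
      (U.tensor V).NIsomorphic δ ((d : ℤ) - 2) (AlgBimodule.regular k B₁) ∧
      (V.tensor U).NIsomorphic δ ((d : ℤ) - 2) (AlgBimodule.regular k B₂) := by
  obtain ⟨U, f, hU, hUr, hf⟩ := AlgBimodule.exists_hom_isReflexiveOnBothSides hex₁l hex₂r hsymm₁₂
    hAG₁ hCM₁ hAG₂ hCM₂ hT (AlgBimodule.dim_torsion_le_of_nIsomorphic hex₁l hex₁r hex₂r hsymm₁₂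
      hγ₁₂ hAG₁ hCM₁ hT hT' hTT' hT'T)
  obtain ⟨V, g, hV, hVr, hg⟩ := AlgBimodule.exists_hom_isReflexiveOnBothSides hex₂l hex₁r hsymm₂₁
    hAG₂ hCM₂ hAG₁ hCM₁ hT' (AlgBimodule.dim_torsion_le_of_nIsomorphic hex₂l hex₂r hex₁r hsymm₂₁
      hγ₂₁ hAG₂ hCM₂ hT' hT hT'T hTT')
  have := hT.2
  have := hT'.2
  have := hU.2
  have := hV.2
  -- Condition `γ` is applied to the original `T'` and `T`, the second factors of the sources `T ⊗
  -- T'` and `T' ⊗ T`.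
  exact ⟨U, V, hU, hV, hUr, hVr,
    .of_isNIso hex₁r (hf.tensor hex₁r hg (hγ₂₁.rightGamma hT')) hTT',
    .of_isNIso hex₂r (hg.tensor hex₂r hf (hγ₁₂.rightGamma hT)) hT'T⟩
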